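/- Let $n\in\mathbb N$, and let $\Sigma\subset\mathbb R^n$ be a compact connected embedded hypersurface of class $C^2$ bounding a bounded domain $\Omega\subset\mathbb R^n$, with outer unit normal field $\nu_\Sigma$. For a compact hypersurface $\Gamma$ of class $C^1$ with unit normal field $\nu_\Gamma$ let $\mathcal N\Gamma=\{(q,\nu_\Gamma(q)):q\in\Gamma\}\subset\mathbb R^{2n}$ be its normal bundle. We say that $\Gamma$ and $\Sigma$ are $C^1$-close of order $\varepsilon$ if $d_H(\mathcal N\Gamma,\mathcal N\Sigma)<\varepsilon$, where $d_H$ is the Hausdorff distance. Let $d_\Sigma(x)$ denote the signed distance of $x\in\mathbb R^n$ to $\Sigma$ (negative exactly in $\Omega$). Then there is $a\in(0,1]$ such that $(p,r)\mapsto p+r\nu_\Sigma(p)$ is a $C^1$-diffeomorphism from $\Sigma\times(-a,a)$ onto $U_a=\{x:\operatorname{dist}(x,\Sigma)<a\}$ (so each $x\in U_a$ has a unique nearest point $\Pi_\Sigma x\in\Sigma$), and there is $\varepsilon_0\in(0,a/3]$ such that for every $\varepsilon\in(0,\varepsilon_0]$ and every compact connected hypersurface $\Gamma\subset\mathbb R^n$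 of class $C^1$ (with continuous unit normal field $\nu_\Gamma$) which is $C^1$-close to $\Sigma$ of order $\varepsilon$, there is a function $\rho:\Sigma\to\mathbb R$ of class $C^1$ with $|\rho|<\varepsilon$ such that: 1. $\Gamma=\{p+\rho(p)\nu_\Sigma(p):p\in\Sigma\}$, and for $x\in U_a$ one has $x\in\Gamma$ if and only if $d_\Sigma(x)=\rho(\Pi_\Sigma x)$; 2. the map $\Phi(p)=p+\rho(p)\nu_\Sigma(p)$ is a $C^1$-diffeomorphism from $\Sigma$ onto $\Gamma$; if moreover $\Sigma$ is of class $C^3$ and $\Gamma$ is of class $C^2$, then $\rho$ is of class $C^2$ and $\Phi$ is a $C^2$-diffeomorphism from $\Sigma$ onto $\Gamma$; 3. $\Gamma$ admits a $C^1$ level function, that is, a function $\psi\in C^1(\mathbb R^n)$ with $\Gamma=\psi^{-1}(0)$ and $\nabla\psi\neq0$ on $\Gamma$. In fact, for every $\chi\in C^\infty(\mathbb R)$ with $0\le\chi\le1$, $\chi(s)=1$ for $|s|\le1$ and $\chi(s)=0$ for $|s|\ge2$, the function $$\psi(x)=\varphi(x)-\rho(\Pi_\Sigma x)\,\chi(3d_\Sigma(x)/a),\qquad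 \varphi(x)=d_\Sigma(x)\chi(3d_\Sigma(x)/a)+\operatorname{sign}(d_\Sigma(x))\,\bigl(1-\chi(3d_\Sigma(x)/a)\bigr),$$ is such a level function (where $|d_\Sigma(x)|\ge 2a/3$ the term containing $\rho$ is zero). -/

import Mathlib

open Set Filter Topology Metric
open scoped ContDiff

noncomputable section

namespace HypSurf

/-- `S ⊆ ℝⁿ` is an (embedded) hypersurface of class `C^k`: every point `p ∈ S` is the centre of a
ball on which some `C^k`-diffeomorphism `Φ` onto an open set, with `Φ p = 0`, straightens `S` to a
coordinate hyperplane. -/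
def IsHypersurface {n : ℕ} (k : WithTop ℕ∞) (S : Set (EuclideanSpace ℝ (Fin n))) : Prop :=
  ∀ p ∈ S, ∃ r : ℝ, 0 < r ∧
    ∃ (Φ : OpenPartialHomeomorph (EuclideanSpace ℝ (Fin n)) (EuclideanSpace ℝ (Fin n)))
      (i : Fin n),
      Φ.source = ball p r ∧ Φ p = 0 ∧
      ContDiffOn ℝ k Φ Φ.source ∧ ContDiffOn ℝ k Φ.symm Φ.target ∧
      ball p r ∩ S = {x ∈ ball p r | Φ x i = 0}

/-- The tangent vectors of `S` at `p`: velocities at `p` of curves running in `S`. -/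
def tangentVectors {n : ℕ} (S : Set (EuclideanSpace ℝ (Fin n))) (p : EuclideanSpace ℝ (Fin n)) :
    Set (EuclideanSpace ℝ (Fin n)) :=
  {v | ∃ γ : ℝ → EuclideanSpace ℝ (Fin n),
    γ 0 = p ∧ (∀ᶠ t in 𝓝 (0 : ℝ), γ t ∈ S) ∧ HasDerivAt γ v 0}

/-- `ν` restricts to a continuous unit normal field on `S`
(its values off `S` are irrelevant). -/
structure IsUnitNormalField {n : ℕ} (S : Set (EuclideanSpace ℝ (Fin n)))
    (ν : EuclideanSpace ℝ (Fin n) → EuclideanSpace ℝ (Fin n)) : Prop where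
  continuousOn : ContinuousOn ν S
  norm_eq_one : ∀ p ∈ S, ‖ν p‖ = 1
  normal : ∀ p ∈ S, ∀ v ∈ tangentVectors S p, inner ℝ (ν p) v = 0

/-- `ν` is the outer unit normal field on `S`, the boundary of `Ω`. -/
structure IsOuterUnitNormalField {n : ℕ} (Ω S : Set (EuclideanSpace ℝ (Fin n)))
    (ν : EuclideanSpace ℝ (Fin n) → EuclideanSpace ℝ (Fin n)) : Prop
    extends IsUnitNormalField S ν where
  outer : ∀ p ∈ S, ∀ᶠ t in 𝓝[>] (0 : ℝ), p + t • ν p ∉ closure Ω ∧ p - t • ν p ∈ Ω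

/-- The normal bundle `{(p, ν p) : p ∈ S}` as a subset of `ℝ²ⁿ = ℝⁿ × ℝⁿ` with its Euclidean
norm. -/
def normalBundle {n : ℕ} (S : Set (EuclideanSpace ℝ (Fin n)))
    (ν : EuclideanSpace ℝ (Fin n) → EuclideanSpace ℝ (Fin n)) :
    Set (WithLp 2 (EuclideanSpace ℝ (Fin n) × EuclideanSpace ℝ (Fin n))) :=
  (fun p => WithLp.toLp 2 (p, ν p)) '' S

/-- `C¹`-closeness of order `ε`: the Hausdorff distance of the normal bundles is below `ε`. -/
def C1Close {n : ℕ} (ε : ℝ) (Γ : Set (EuclideanSpace ℝ (Fin n)))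
    (νΓ : EuclideanSpace ℝ (Fin n) → EuclideanSpace ℝ (Fin n))
    (S : Set (EuclideanSpace ℝ (Fin n)))
    (νS : EuclideanSpace ℝ (Fin n) → EuclideanSpace ℝ (Fin n)) : Prop :=
  hausdorffDist (normalBundle Γ νΓ) (normalBundle S νS) < ε

section Maps

variable {E F : Type*} [NormedAddCommGroup E] [NormedSpace ℝ E]
  [NormedAddCommGroup F] [NormedSpace ℝ F]

/-- `f` is of class `C^k` on the subset `S` of a normed space: near each point of `S` it is the
restriction to `S` of a `C^k` map defined on a neighbourhood in the ambient space. On an embedded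
`C^k` submanifold this is the same as being `C^k` in local charts. -/
def IsCkOn (k : WithTop ℕ∞) (S : Set E) (f : E → F) : Prop :=
  ∀ p ∈ S, ∃ U : Set E, IsOpen U ∧ p ∈ U ∧ ∃ g : E → F, ContDiffOn ℝ k g U ∧ EqOn f g (S ∩ U)

/-- `f` restricts to a `C^k`-diffeomorphism from `S` onto `T`. -/
def IsCkDiffeo (k : WithTop ℕ∞) (S : Set E) (T : Set F) (f : E → F) : Prop :=
  IsCkOn k S f ∧ MapsTo f S T ∧
    ∃ g : F → E, IsCkOn k T g ∧ MapsTo g T S ∧ InvOn g f S T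

end Maps

/-- `S` has a tubular neighbourhood of width `a`: the map `(p, r) ↦ p + r ν(p)` is a
`C¹`-diffeomorphism from `S × (-a, a)` onto the set `U_a` of points at distance less than `a`
from `S`. -/
def IsTubularWidth {n : ℕ} (S : Set (EuclideanSpace ℝ (Fin n)))
    (ν : EuclideanSpace ℝ (Fin n) → EuclideanSpace ℝ (Fin n)) (a : ℝ) : Prop :=
  IsCkDiffeo 1 (S ×ˢ Ioo (-a) a) {x | infDist x S < a}
    (fun z : EuclideanSpace ℝ (Fin n) × ℝ => z.1 + z.2 • ν z.1)

open Classical in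
/-- A point of `S` nearest to `x` (unique for `x` in a tubular neighbourhood). -/
def nearestPoint {n : ℕ} (S : Set (EuclideanSpace ℝ (Fin n))) (x : EuclideanSpace ℝ (Fin n)) :
    EuclideanSpace ℝ (Fin n) :=
  Classical.epsilon fun p => p ∈ S ∧ dist x p = infDist x S

open Classical in
/-- The signed distance to `S`, the boundary of `Ω`; negative exactly in `Ω`. -/
def signedDist {n : ℕ} (Ω S : Set (EuclideanSpace ℝ (Fin n))) (x : EuclideanSpace ℝ (Fin n)) : ℝ :=
  if x ∈ Ω then -infDist x S else infDist x S

/-- A smooth cut-off function, `1` on `[-1, 1]` and `0` off `(-2, 2)`. -/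
structure IsCutoff (χ : ℝ → ℝ) : Prop where
  smooth : ContDiff ℝ ∞ χ
  eq_one : ∀ s, |s| ≤ 1 → χ s = 1
  eq_zero : ∀ s, 2 ≤ |s| → χ s = 0
  nonneg : ∀ s, 0 ≤ χ s
  le_one : ∀ s, χ s ≤ 1

/-- The canonical level function `φ` of `S`. Where `|d| ≥ 2a/3`, in particular off the tubular
neighbourhood, the formula gives `-1` in `Ω` and `1` outside. -/
def canonicalLevel {n : ℕ} (Ω S : Set (EuclideanSpace ℝ (Fin n))) (a : ℝ) (χ : ℝ → ℝ)
    (x : EuclideanSpace ℝ (Fin n)) : ℝ :=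
  signedDist Ω S x * χ (3 * signedDist Ω S x / a) +
    Real.sign (signedDist Ω S x) * (1 - χ (3 * signedDist Ω S x / a))

/-- `ψ` is a (regular) `C¹` level function for `Γ`: `Γ = ψ⁻¹(0)` and the derivative of `ψ` does
not vanish on `Γ`. -/
structure IsC1LevelFunction {n : ℕ} (Γ : Set (EuclideanSpace ℝ (Fin n)))
    (ψ : EuclideanSpace ℝ (Fin n) → ℝ) : Prop where
  contDiff : ContDiff ℝ 1 ψ
  zeroSet : ψ ⁻¹' {0} = Γ
  regular : ∀ x ∈ Γ, fderiv ℝ ψ x ≠ 0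

end HypSurf

end

/-! Everything rests on one estimate, `QuadraticBound`: for a compact C² surface the chord `y - x`
has normal component at most `C * ‖y - x‖ ^ 2`. With `4 * C * a ≤ 1` it does two jobs. Globally, two
normal segments of length below `a` cannot meet (`QuadraticBound.injective`). Infinitesimally, the
second fundamental form is bounded by `2 * C`, so the differential of `(p, r) ↦ p + r ν(p)` is
invertible for `|r| < a`. Hence nearest point `P` and signed distance `R` are C¹ coordinates on the
tube (`IsTube`, `IsTube.contDiffOn`).

If Γ is C¹-close to Σ, it lies in the tube and its normal at `q` is less than distance 1 from the
normal of Σ at `P q`, so Γ is transversal to the normal lines. By the inverse function theorem `P :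
Γ → Σ` is then locally injective and has local C¹ sections (`IsTube.exists_isLocalSection`). Its
image is open and compact, hence all of the connected Σ. Connectedness of Γ alone would still allow
several sheets, but `R` orders each fibre: the points of Γ lowest in their fibre form a nonempty
clopen set, hence all of Γ, so there is one sheet (`IsTube.bijOn_proj`).

Then `ρ` is `R` read through the inverse of `P`, and its regularity is that of the local sections.
The C² statement concerns the same `ρ`; only the sections are redone in class C². -/

namespace HypSurf

local notation "𝔼" n:max => EuclideanSpace ℝ (Fin n)

/-! ### Defining functions and unit normals -/

/-- A map with injective derivative at a point of a finite-dimensional space has a local inverse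
of the same class. -/
theorem exists_contDiffOn_localInverse {X : Type*} [NormedAddCommGroup X] [NormedSpace ℝ X]
    [FiniteDimensional ℝ X] {k : WithTop ℕ∞} (hk : 1 ≤ k) (hk' : k ≠ ∞) {F : X → X} {x₀ : X}
    (hF : ContDiffAt ℝ k F x₀) (hinj : ∀ v, fderiv ℝ F x₀ v = 0 → v = 0) :
    ∃ e : OpenPartialHomeomorph X X, ⇑e = F ∧ x₀ ∈ e.source ∧
      ∃ V : Set X, IsOpen V ∧ F x₀ ∈ V ∧ V ⊆ e.target ∧ ContDiffOn ℝ k e.symm V := by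
  have : CompleteSpace X := FiniteDimensional.complete ℝ X
  have hk0 : k ≠ 0 := by rintro rfl; simp at hk
  have hinj' : Function.Injective (fderiv ℝ F x₀ : X →ₗ[ℝ] X) :=
    (injective_iff_map_eq_zero _).2 hinj
  let A : X ≃L[ℝ] X := (LinearEquiv.ofInjectiveEndo _ hinj').toContinuousLinearEquiv
  have hA : (A : X →L[ℝ] X) = fderiv ℝ F x₀ := by ext v; rfl
  have hd : HasFDerivAt F (A : X →L[ℝ] X) x₀ := by
    rw [hA]; exact (hF.differentiableAt hk0).hasFDerivAt
  refine ⟨hF.toOpenPartialHomeomorph F hd hk0, rfl,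
    hF.mem_toOpenPartialHomeomorph_source hd hk0, ?_⟩
  have h1 := hF.to_localInverse hd hk0
  -- Being C^k at a point spreads to a neighbourhood only for `k ≠ ∞`; for `∞` the neighbourhood may
  -- shrink with the order.
  have h2 := h1.eventually hk'
  have h3 : ∀ᶠ y in 𝓝 (F x₀), y ∈ (hF.toOpenPartialHomeomorph F hd hk0).target :=
    (hF.toOpenPartialHomeomorph F hd hk0).open_target.mem_nhds
      (hF.image_mem_toOpenPartialHomeomorph_target hd hk0)
  obtain ⟨V, hV, hVo, hxV⟩ := _root_.eventually_nhds_iff.1 (h2.and h3)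
  exact ⟨V, hVo, hxV, fun y hy => (hV y hy).2, fun y hy => (hV y hy).1.contDiffWithinAt⟩

/-- A hypersurface is locally the regular zero set of a function, and the kernel of the derivative
of that function consists of tangent vectors. -/
theorem IsHypersurface.exists_definingFunction {n : ℕ} {k : WithTop ℕ∞} (hk : 1 ≤ k)
    {S : Set (𝔼 n)} (hS : IsHypersurface k S) {p : 𝔼 n} (hp : p ∈ S) :
    ∃ r : ℝ, 0 < r ∧ ∃ g : 𝔼 n → ℝ, ContDiffOn ℝ k g (ball p r) ∧
      (∀ x ∈ ball p r, x ∈ S ↔ g x = 0) ∧ (∀ x ∈ ball p r, ∃ w, fderiv ℝ g x w = 1) ∧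
      ∀ x ∈ ball p r, x ∈ S → ∀ v, fderiv ℝ g x v = 0 → v ∈ tangentVectors S x := by
  obtain ⟨r, hr, Φ, i, hsrc, -, hΦ, hΦs, hSΦ⟩ := hS p hp
  have hk0 : k ≠ 0 := by rintro rfl; simp at hk
  have hmem : ∀ x ∈ ball p r, x ∈ S ↔ Φ x i = 0 := fun x hx => by
    have := Set.ext_iff.1 hSΦ x
    simp only [mem_inter_iff, mem_ofPred_eq, hx, true_and] at this
    exact this
  rw [hsrc] at hΦ
  have hdΦ : ∀ x ∈ ball p r, HasFDerivAt Φ (fderiv ℝ Φ x) x := fun x hx =>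
    ((hΦ.contDiffAt (isOpen_ball.mem_nhds hx)).differentiableAt hk0).hasFDerivAt
  have htgt : ∀ x ∈ ball p r, Φ x ∈ Φ.target := fun x hx => Φ.map_source (hsrc ▸ hx)
  have hdΦs : ∀ x ∈ ball p r, HasFDerivAt Φ.symm (fderiv ℝ Φ.symm (Φ x)) (Φ x) := fun x hx =>
    ((hΦs.contDiffAt (Φ.open_target.mem_nhds (htgt x hx))).differentiableAt hk0).hasFDerivAt
  have hleft : ∀ x ∈ ball p r, Φ.symm (Φ x) = x := fun x hx => Φ.left_inv (hsrc ▸ hx)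
  have hcomp1 : ∀ x ∈ ball p r, ∀ v, fderiv ℝ Φ x (fderiv ℝ Φ.symm (Φ x) v) = v := by
    intro x hx v
    have h1 : HasFDerivAt (Φ ∘ Φ.symm) ((fderiv ℝ Φ x).comp (fderiv ℝ Φ.symm (Φ x))) (Φ x) :=
      HasFDerivAt.comp _ (by rw [hleft x hx]; exact hdΦ x hx) (hdΦs x hx)
    have h2 : Φ ∘ Φ.symm =ᶠ[𝓝 (Φ x)] id := by
      filter_upwards [Φ.open_target.mem_nhds (htgt x hx)] with y hy using Φ.right_inv hy
    have h3 := (h1.congr_of_eventuallyEq h2.symm).unique (hasFDerivAt_id _)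
    simpa using DFunLike.congr_fun h3 v
  have hcomp2 : ∀ x ∈ ball p r, ∀ v, fderiv ℝ Φ.symm (Φ x) (fderiv ℝ Φ x v) = v := by
    intro x hx v
    have h1 : HasFDerivAt (Φ.symm ∘ Φ) ((fderiv ℝ Φ.symm (Φ x)).comp (fderiv ℝ Φ x)) x :=
      HasFDerivAt.comp _ (hdΦs x hx) (hdΦ x hx)
    have h2 : Φ.symm ∘ Φ =ᶠ[𝓝 x] id := by
      filter_upwards [isOpen_ball.mem_nhds hx] with y hy using hleft y hy
    have h3 := (h1.congr_of_eventuallyEq h2.symm).unique (hasFDerivAt_id _)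
    simpa using DFunLike.congr_fun h3 v
  have hdg : ∀ x ∈ ball p r, HasFDerivAt (fun y => Φ y i)
      ((EuclideanSpace.proj i : 𝔼 n →L[ℝ] ℝ).comp (fderiv ℝ Φ x)) x := fun x hx =>
    (EuclideanSpace.proj i : 𝔼 n →L[ℝ] ℝ).hasFDerivAt.comp x (hdΦ x hx)
  refine ⟨r, hr, fun x => Φ x i, ?_, hmem, ?_, ?_⟩
  · exact (EuclideanSpace.proj i : 𝔼 n →L[ℝ] ℝ).contDiff.comp_contDiffOn hΦ
  · intro x hx
    refine ⟨fderiv ℝ Φ.symm (Φ x) (EuclideanSpace.single i 1), ?_⟩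
    rw [(hdg x hx).fderiv]
    simp [hcomp1 x hx]
  · intro x hx hxS v hv
    rw [(hdg x hx).fderiv] at hv
    have hvi : (fderiv ℝ Φ x v) i = 0 := by simpa using hv
    -- The curve is the preimage of a straight line in the chart; since `v` is in the kernel, that
    -- line stays in the coordinate hyperplane.
    have hl : HasDerivAt (fun t : ℝ => Φ x + t • fderiv ℝ Φ x v) (fderiv ℝ Φ x v) 0 := by
      simpa using ((hasDerivAt_id (0 : ℝ)).smul_const (fderiv ℝ Φ x v)).const_add (Φ x)
    refine ⟨fun t => Φ.symm (Φ x + t • fderiv ℝ Φ x v), by simp [hleft x hx], ?_, ?_⟩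
    · have hc : Tendsto (fun t : ℝ => Φ x + t • fderiv ℝ Φ x v) (𝓝 0) (𝓝 (Φ x)) := by
        simpa using hl.continuousAt.tendsto
      filter_upwards [hc.eventually (Φ.open_target.mem_nhds (htgt x hx))] with t ht
      have hb : Φ.symm (Φ x + t • fderiv ℝ Φ x v) ∈ ball p r := hsrc ▸ Φ.map_target ht
      rw [hmem _ hb, Φ.right_inv ht]
      simp [hvi, (hmem x hx).1 hxS]
    · have h0 : HasFDerivAt Φ.symm (fderiv ℝ Φ.symm (Φ x)) (Φ x + (0 : ℝ) • fderiv ℝ Φ x v) := by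
        simpa using hdΦs x hx
      have := h0.comp_hasDerivAt (0 : ℝ) hl
      rwa [hcomp2 x hx] at this

/-- The derivative of a defining function is a nonzero multiple of the normal. -/
theorem exists_smul_normal {n : ℕ} {S : Set (𝔼 n)} {ν : 𝔼 n → 𝔼 n}
    (hν : IsUnitNormalField S ν) {x : 𝔼 n} (hx : x ∈ S) {A : 𝔼 n →L[ℝ] ℝ}
    (hA : ∃ w, A w = 1) (hker : ∀ v, A v = 0 → v ∈ tangentVectors S x) :
    A (ν x) ≠ 0 ∧ ∀ v, A v = A (ν x) * inner ℝ (ν x) v := by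
  obtain ⟨w, hw⟩ := hA
  have key : ∀ v, inner ℝ (ν x) v = A v * inner ℝ (ν x) w := fun v => by
    have h := hν.normal x hx _ (hker (v - A v • w) (by simp [hw]))
    rw [inner_sub_right, inner_smul_right] at h
    linarith
  have h1 : (1 : ℝ) = A (ν x) * inner ℝ (ν x) w := by
    rw [← key, real_inner_self_eq_norm_sq, hν.norm_eq_one x hx]; norm_num
  have hc : A (ν x) ≠ 0 := by intro h; simp [h] at h1
  refine ⟨hc, fun v => ?_⟩
  rw [key v]
  linear_combination A v * h1

/-- A vector orthogonal to the tangent space is a multiple of the normal. -/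
theorem eq_inner_smul_normal {n : ℕ} {k : WithTop ℕ∞} (hk : 1 ≤ k) {S : Set (𝔼 n)}
    (hS : IsHypersurface k S) {ν : 𝔼 n → 𝔼 n}
    (hν : IsUnitNormalField S ν) {p : 𝔼 n} (hp : p ∈ S) {u : 𝔼 n}
    (hu : ∀ v ∈ tangentVectors S p, inner ℝ u v = 0) : u = (inner ℝ u (ν p) : ℝ) • ν p := by
  obtain ⟨r, hr, g, -, -, hw, hker⟩ := hS.exists_definingFunction hk hp
  have hpb := mem_ball_self (x := p) hr
  obtain ⟨-, h2⟩ := exists_smul_normal hν hp (hw p hpb) (hker p hpb hp)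
  have hn : inner ℝ (ν p) (ν p) = (1 : ℝ) := by
    rw [real_inner_self_eq_norm_sq, hν.norm_eq_one p hp]; norm_num
  have ht : u - (inner ℝ u (ν p) : ℝ) • ν p ∈ tangentVectors S p := by
    refine hker p hpb hp _ ?_
    rw [h2, inner_sub_right, inner_smul_right, hn, real_inner_comm]; ring
  have h3 := hu _ ht
  have h4 := hν.normal p hp _ ht
  rw [← sub_eq_zero, ← inner_self_eq_zero (𝕜 := ℝ)]
  nth_rewrite 1 [inner_sub_left]
  rw [inner_smul_left, h3, h4]; simp

/-- The unit normal field of a `C^(k+1)` hypersurface extends locally to a `C^k` map. -/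
theorem IsHypersurface.exists_normal_extension {n : ℕ} {k : WithTop ℕ∞}
    {S : Set (𝔼 n)} (hS : IsHypersurface (k + 1) S) {ν : 𝔼 n → 𝔼 n}
    (hν : IsUnitNormalField S ν) {p : 𝔼 n} (hp : p ∈ S) :
    ∃ r : ℝ, 0 < r ∧ ∃ (g : 𝔼 n → ℝ) (N : 𝔼 n → 𝔼 n), ContDiffOn ℝ (k + 1) g (ball p r) ∧
      (∀ x ∈ ball p r, x ∈ S ↔ g x = 0) ∧ (∀ x ∈ ball p r, ∃ w, fderiv ℝ g x w = 1) ∧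
      (∀ x ∈ ball p r, x ∈ S → ∀ v, fderiv ℝ g x v = 0 → v ∈ tangentVectors S x) ∧
      ContDiffOn ℝ k N (ball p r) ∧ ∀ x ∈ ball p r, x ∈ S → N x = ν x := by
  obtain ⟨r, hr, g, hg, hmem, hw, hker⟩ := hS.exists_definingFunction le_add_self hp
  have hpb := mem_ball_self (x := p) hr
  have hdg : ContDiffOn ℝ k (fderiv ℝ g) (ball p r) := hg.fderiv_of_isOpen isOpen_ball le_rfl
  set D := (InnerProductSpace.toDual ℝ (𝔼 n)).symm with hD
  have hgrad : ContDiffOn ℝ k (fun x => D (fderiv ℝ g x)) (ball p r) :=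
    D.toContinuousLinearEquiv.contDiff.comp_contDiffOn hdg
  have hne : ∀ x ∈ ball p r, D (fderiv ℝ g x) ≠ 0 := by
    intro x hx h
    obtain ⟨w, hw⟩ := hw x hx
    rw [LinearIsometryEquiv.map_eq_zero_iff] at h
    simp [h] at hw
  have hc := fun x (hx : x ∈ ball p r) (hxS : x ∈ S) =>
    exists_smul_normal hν hxS (hw x hx) (hker x hx hxS)
  have hgν : ∀ x ∈ ball p r, x ∈ S → D (fderiv ℝ g x) = fderiv ℝ g x (ν x) • ν x := by
    intro x hx hxS
    refine ext_inner_right ℝ fun v => ?_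
    rw [hD, InnerProductSpace.toDual_symm_apply, (hc x hx hxS).2 v, inner_smul_left]
    simp
  set s : ℝ := fderiv ℝ g p (ν p) with hs
  have hs0 : s ≠ 0 := (hc p hpb hp).1
  have hcont : ContinuousWithinAt (fun x => s * fderiv ℝ g x (ν x)) S p :=
    continuousWithinAt_const.mul
      (((hdg.continuousOn.continuousAt (isOpen_ball.mem_nhds hpb)).continuousWithinAt).clm_apply
        (hν.continuousOn p hp))
  -- The normalised gradient is `ν` up to a sign. By continuity of `ν` this sign is constant on `S`
  -- near `p`, so the factor `s / |s|` corrects it.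
  have hpos : ∀ᶠ x in 𝓝[S] p, 0 < s * fderiv ℝ g x (ν x) :=
    hcont.eventually (lt_mem_nhds (mul_self_pos.2 hs0))
  obtain ⟨r', hr', hpos⟩ := Metric.mem_nhdsWithin_iff.1 hpos
  have hsub : ball p (min r r') ⊆ ball p r := ball_subset_ball (min_le_left _ _)
  refine ⟨min r r', lt_min hr hr', g,
    fun x => (s / |s|) • (‖D (fderiv ℝ g x)‖⁻¹ • D (fderiv ℝ g x)), hg.mono hsub,
    fun x hx => hmem x (hsub hx), fun x hx => hw x (hsub hx), fun x hx => hker x (hsub hx), ?_, ?_⟩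
  · have hnorm : ContDiffOn ℝ k (fun x => ‖D (fderiv ℝ g x)‖) (ball p (min r r')) :=
      (hgrad.mono hsub).norm ℝ fun x hx => hne x (hsub hx)
    exact ((hnorm.inv fun x hx => norm_ne_zero_iff.2 (hne x (hsub hx))).smul
      (hgrad.mono hsub)).const_smul (s / |s|)
  · intro x hx hxS
    have h1 : 0 < s * fderiv ℝ g x (ν x) :=
      hpos ⟨ball_subset_ball (min_le_right _ _) hx, hxS⟩
    beta_reduce
    rw [hgν x (hsub hx) hxS, norm_smul, hν.norm_eq_one x hxS, smul_smul, smul_smul]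
    have h2 : s / |s| * (‖fderiv ℝ g x (ν x)‖ * 1)⁻¹ * fderiv ℝ g x (ν x) = 1 := by
      have hx0 : fderiv ℝ g x (ν x) ≠ 0 := (hc x (hsub hx) hxS).1
      rw [Real.norm_eq_abs, mul_one, div_mul_eq_mul_div, div_mul_eq_mul_div, mul_right_comm,
        ← div_eq_mul_inv, div_div, mul_comm |fderiv ℝ g x (ν x)|, ← abs_mul, abs_of_pos h1]
      exact div_self h1.ne'
    rw [h2, one_smul]

theorem IsHypersurface.isCkOn_normal {n : ℕ} {k : WithTop ℕ∞}
    {S : Set (𝔼 n)} (hS : IsHypersurface (k + 1) S) {ν : 𝔼 n → 𝔼 n}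
    (hν : IsUnitNormalField S ν) : IsCkOn k S ν := by
  intro p hp
  obtain ⟨r, hr, -, N, -, -, -, -, hN, hNν⟩ := hS.exists_normal_extension hν hp
  exact ⟨ball p r, isOpen_ball, mem_ball_self hr, N, hN, fun x hx => (hNν x hx.2 hx.1).symm⟩

/-! ### The quadratic chord estimate and injectivity of the normal map -/

/-- Chords of `S` deviate from the tangent spaces at most quadratically. -/
def QuadraticBound {n : ℕ} (S : Set (𝔼 n)) (ν : 𝔼 n → 𝔼 n) (C : ℝ) : Prop :=
  ∀ x ∈ S, ∀ y ∈ S, |inner ℝ (ν x) (y - x)| ≤ C * ‖y - x‖ ^ 2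

/-- A defining function `g` with Lipschitz derivative vanishes at both ends of the chord, so its
quadratic Taylor remainder is all of `Dg_x (y - x)`. This is the normal component of the chord times
a factor bounded away from 0. -/
theorem exists_local_quadraticBound {n : ℕ} {S : Set (𝔼 n)} (hS : IsHypersurface 2 S)
    {ν : 𝔼 n → 𝔼 n} (hν : IsUnitNormalField S ν) {p : 𝔼 n} (hp : p ∈ S) :
    ∃ r : ℝ, 0 < r ∧ ∃ C : ℝ, QuadraticBound (S ∩ ball p r) ν C := by
  obtain ⟨r, hr, g, hg, hmem, hw, hker⟩ := hS.exists_definingFunction one_le_two hp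
  have hpb := mem_ball_self (x := p) hr
  have hdg : ContDiffOn ℝ 1 (fderiv ℝ g) (ball p r) :=
    hg.fderiv_of_isOpen isOpen_ball (by norm_num)
  obtain ⟨K, t, ht, hK⟩ :=
    (hdg.contDiffAt (isOpen_ball.mem_nhds hpb)).exists_lipschitzOnWith
  obtain ⟨r₁, hr₁, hr₁t⟩ := Metric.mem_nhds_iff.1 ht
  have hc := fun x (hx : x ∈ ball p r) (hxS : x ∈ S) =>
    exists_smul_normal hν hxS (hw x hx) (hker x hx hxS)
  set s : ℝ := |fderiv ℝ g p (ν p)| with hs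
  have hs0 : 0 < s := abs_pos.2 (hc p hpb hp).1
  have hcont : ContinuousWithinAt (fun x => |fderiv ℝ g x (ν x)|) S p :=
    (((hdg.continuousOn.continuousAt (isOpen_ball.mem_nhds hpb)).continuousWithinAt).clm_apply
        (hν.continuousOn p hp)).abs
  obtain ⟨r₂, hr₂, hpos⟩ := Metric.mem_nhdsWithin_iff.1
    (hcont.eventually (lt_mem_nhds (half_lt_self hs0)))
  refine ⟨min r (min r₁ r₂), by positivity, K / (s / 2), ?_⟩
  rintro x ⟨hxS, hx⟩ y ⟨hyS, hy⟩
  have hsub : ball p (min r (min r₁ r₂)) ⊆ ball p r := ball_subset_ball (min_le_left _ _)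
  have hsub₁ : ball p (min r (min r₁ r₂)) ⊆ t :=
    (ball_subset_ball ((min_le_right _ _).trans (min_le_left _ _))).trans hr₁t
  have hx2 : s / 2 < |fderiv ℝ g x (ν x)| :=
    hpos ⟨ball_subset_ball ((min_le_right _ _).trans (min_le_right _ _)) hx, hxS⟩
  have hseg : segment ℝ x y ⊆ ball p (min r (min r₁ r₂)) :=
    (convex_ball _ _).segment_subset hx hy
  have hT : ‖g y - g x - fderiv ℝ g x (y - x)‖ ≤ (K * ‖y - x‖) * ‖y - x‖ := by
    refine (convex_segment x y).norm_image_sub_le_of_norm_hasFDerivWithin_le'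
      (f' := fderiv ℝ g) (fun z hz => ?_) (fun z hz => ?_)
      (left_mem_segment ℝ x y) (right_mem_segment ℝ x y)
    · exact ((hg.contDiffAt (isOpen_ball.mem_nhds (hsub (hseg hz)))).differentiableAt
        two_ne_zero).hasFDerivAt.hasFDerivWithinAt
    · have h1 := hK.dist_le_mul z (hsub₁ (hseg hz)) x (hsub₁ hx)
      rw [dist_eq_norm, dist_eq_norm] at h1
      refine h1.trans (mul_le_mul_of_nonneg_left ?_ K.coe_nonneg)
      obtain ⟨θ, hθ, rfl⟩ := (segment_eq_image' ℝ x y ▸ hz :)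
      rw [add_sub_cancel_left, norm_smul, Real.norm_of_nonneg hθ.1]
      exact mul_le_of_le_one_left (norm_nonneg _) hθ.2
  rw [(hmem x (hsub hx)).1 hxS, (hmem y (hsub hy)).1 hyS, (hc x (hsub hx) hxS).2, sub_self,
    zero_sub, norm_neg, norm_mul, Real.norm_eq_abs, Real.norm_eq_abs] at hT
  rw [div_mul_eq_mul_div, le_div_iff₀ (by positivity)]
  calc |inner ℝ (ν x) (y - x)| * (s / 2) ≤ |inner ℝ (ν x) (y - x)| * |fderiv ℝ g x (ν x)| :=
        mul_le_mul_of_nonneg_left hx2.le (abs_nonneg _)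
    _ ≤ K * ‖y - x‖ ^ 2 := by linarith

/-- Short chords are covered by the local bounds and compactness; a chord of length at least `δ`
satisfies the bound with `δ⁻¹` by Cauchy–Schwarz. Taking `1 ≤ C` later makes `a = 1 / (4 * C)` at
most 1. -/
theorem exists_quadraticBound {n : ℕ} {S : Set (𝔼 n)} (hS : IsHypersurface 2 S)
    (hSk : IsCompact S) {ν : 𝔼 n → 𝔼 n} (hν : IsUnitNormalField S ν) :
    ∃ C : ℝ, 1 ≤ C ∧ QuadraticBound S ν C := by
  have key : ∃ C : ℝ, ∃ δ : ℝ, 0 < δ ∧ ∀ x ∈ S, ∀ y ∈ S, dist y x < δ →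
      |inner ℝ (ν x) (y - x)| ≤ C * ‖y - x‖ ^ 2 := by
    -- Only `x` is confined to `s`, while `y` ranges over all of `S`; otherwise the property would
    -- not pass to unions.
    refine hSk.induction_on (p := fun s => ∃ C : ℝ, ∃ δ : ℝ, 0 < δ ∧ ∀ x ∈ s, ∀ y ∈ S,
      dist y x < δ → |inner ℝ (ν x) (y - x)| ≤ C * ‖y - x‖ ^ 2) ⟨0, 1, one_pos, by simp⟩ ?_ ?_ ?_
    · rintro s t hst ⟨C, δ, hδ, h⟩
      exact ⟨C, δ, hδ, fun x hx => h x (hst hx)⟩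
    · rintro s t ⟨C, δ, hδ, h⟩ ⟨C', δ', hδ', h'⟩
      refine ⟨max C C', min δ δ', lt_min hδ hδ', ?_⟩
      rintro x (hx | hx) y hy hxy
      · exact (h x hx y hy (hxy.trans_le (min_le_left _ _))).trans
          (mul_le_mul_of_nonneg_right (le_max_left _ _) (sq_nonneg _))
      · exact (h' x hx y hy (hxy.trans_le (min_le_right _ _))).trans
          (mul_le_mul_of_nonneg_right (le_max_right _ _) (sq_nonneg _))
    · intro p hp
      obtain ⟨r, hr, C, hC⟩ := exists_local_quadraticBound hS hν hp
      refine ⟨S ∩ ball p (r / 2), inter_mem_nhdsWithin _ (ball_mem_nhds p (half_pos hr)),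
        C, r / 2, half_pos hr, fun x hx y hy hxy => ?_⟩
      have hx2 := mem_ball.1 hx.2
      refine hC x ⟨hx.1, mem_ball.2 (by linarith)⟩ y ⟨hy, mem_ball.2 ?_⟩
      linarith [dist_triangle y x p]
  obtain ⟨C, δ, hδ, h⟩ := key
  refine ⟨max 1 (max C δ⁻¹), le_max_left _ _, fun x hx y hy => ?_⟩
  rcases lt_or_ge (dist y x) δ with hlt | hge
  · exact (h x hx y hy hlt).trans (mul_le_mul_of_nonneg_right
      ((le_max_left _ _).trans (le_max_right _ _)) (sq_nonneg _))
  · rw [dist_eq_norm] at hge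
    calc |inner ℝ (ν x) (y - x)| ≤ ‖ν x‖ * ‖y - x‖ := abs_real_inner_le_norm _ _
      _ = δ⁻¹ * (δ * ‖y - x‖) := by rw [hν.norm_eq_one x hx]; field_simp
      _ ≤ δ⁻¹ * (‖y - x‖ * ‖y - x‖) := by gcongr
      _ ≤ _ := by
        rw [← sq]
        exact mul_le_mul_of_nonneg_right ((le_max_right _ _).trans (le_max_right _ _))
          (sq_nonneg _)

/-- Pairing `p - q = s ν(q) - r ν(p)` with `p - q` gives `‖p - q‖² ≤ 2 a C ‖p - q‖² ≤ ‖p - q‖² / 2`.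
-/
theorem QuadraticBound.injective {n : ℕ} {S : Set (𝔼 n)} {ν : 𝔼 n → 𝔼 n} {C a : ℝ}
    (hC : QuadraticBound S ν C) (hν : IsUnitNormalField S ν) (ha : 4 * C * a ≤ 1)
    {p q : 𝔼 n} (hp : p ∈ S) (hq : q ∈ S) {r s : ℝ} (hr : |r| < a) (hs : |s| < a)
    (h : p + r • ν p = q + s • ν q) : p = q ∧ r = s := by
  have ha0 : 0 ≤ a := (abs_nonneg r).trans hr.le
  have hpq : p = q := by
    have h1 : p - q = s • ν q - r • ν p := by
      rw [sub_eq_sub_iff_add_eq_add, h, add_comm]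
    have h2 : ‖p - q‖ ^ 2 = s * inner ℝ (ν q) (p - q) + r * inner ℝ (ν p) (q - p) := by
      rw [← real_inner_self_eq_norm_sq]
      nth_rewrite 1 [h1]
      rw [inner_sub_left, real_inner_smul_left, real_inner_smul_left, ← neg_sub q p,
        inner_neg_right, inner_neg_right]
      ring
    have h3 : s * inner ℝ (ν q) (p - q) ≤ a * (C * ‖p - q‖ ^ 2) :=
      (le_abs_self _).trans (by rw [abs_mul]; gcongr; exact hC q hq p hp)
    have h4 : r * inner ℝ (ν p) (q - p) ≤ a * (C * ‖p - q‖ ^ 2) :=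
      (le_abs_self _).trans (by
        rw [abs_mul, norm_sub_rev p q]; gcongr; exact hC p hp q hq)
    have h5 : ‖p - q‖ ^ 2 ≤ 0 := by nlinarith [sq_nonneg ‖p - q‖]
    have h6 : ‖p - q‖ = 0 := by nlinarith [norm_nonneg (p - q)]
    exact sub_eq_zero.1 (norm_eq_zero.1 h6)
  subst hpq
  refine ⟨rfl, ?_⟩
  have hne : ν p ≠ 0 := by rw [← norm_ne_zero_iff, hν.norm_eq_one p hp]; exact one_ne_zero
  exact smul_left_injective ℝ hne (add_left_cancel h)

/-! ### Nearest points, signed distance and the tube -/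

theorem nearestPoint_spec {n : ℕ} {S : Set (𝔼 n)} (hSk : IsCompact S) (hne : S.Nonempty)
    (x : 𝔼 n) : nearestPoint S x ∈ S ∧ dist x (nearestPoint S x) = infDist x S := by
  obtain ⟨y, hy, h⟩ := hSk.exists_infDist_eq_dist hne x
  exact Classical.epsilon_spec (p := fun p => p ∈ S ∧ dist x p = infDist x S) ⟨y, hy, h.symm⟩

/-- The segment from `x` to a nearest point of `S` is normal to `S`. -/
theorem eq_add_smul_of_dist_eq_infDist {n : ℕ} {S : Set (𝔼 n)} {k : WithTop ℕ∞} (hk : 1 ≤ k)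
    (hS : IsHypersurface k S)
    {ν : 𝔼 n → 𝔼 n} (hν : IsUnitNormalField S ν) {x p : 𝔼 n} (hp : p ∈ S)
    (hxp : dist x p = infDist x S) : ∃ r : ℝ, |r| = infDist x S ∧ p + r • ν p = x := by
  have h := eq_inner_smul_normal hk hS hν hp (u := x - p) (by
    rintro v ⟨γ, h0, hγ, hd⟩
    have h1 := (hd.const_sub x).norm_sq
    have h2 : IsLocalMin (fun t => ‖x - γ t‖ ^ 2) 0 := by
      filter_upwards [hγ] with t ht
      rw [h0, ← dist_eq_norm, ← dist_eq_norm, hxp]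
      exact pow_le_pow_left₀ infDist_nonneg (infDist_le_dist_of_mem ht) 2
    have h3 := h2.hasDerivAt_eq_zero h1
    rw [h0, inner_neg_right] at h3
    linarith)
  refine ⟨inner ℝ (x - p) (ν p), ?_, by rw [← h]; abel⟩
  rw [← hxp, dist_eq_norm, h, norm_smul, hν.norm_eq_one p hp, ← h]
  simp

/-- `P` and `R` are the components of the inverse of `(p, r) ↦ p + r ν(p)` on the tube of
width `a`. -/
structure IsTube {n : ℕ} (S : Set (𝔼 n)) (ν : 𝔼 n → 𝔼 n) (a : ℝ)
    (P : 𝔼 n → 𝔼 n) (R : 𝔼 n → ℝ) : Prop where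
  proj_mem : ∀ x, infDist x S < a → P x ∈ S
  abs_lt : ∀ x, infDist x S < a → |R x| < a
  add_eq : ∀ x, infDist x S < a → P x + R x • ν (P x) = x
  infDist_lt : ∀ p ∈ S, ∀ r, |r| < a → infDist (p + r • ν p) S < a
  proj_eq : ∀ p ∈ S, ∀ r, |r| < a → P (p + r • ν p) = p
  height_eq : ∀ p ∈ S, ∀ r, |r| < a → R (p + r • ν p) = r

theorem infDist_add_smul_le {n : ℕ} {S : Set (𝔼 n)} {ν : 𝔼 n → 𝔼 n}
    (hν : IsUnitNormalField S ν) {p : 𝔼 n} (hp : p ∈ S) (r : ℝ) :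
    infDist (p + r • ν p) S ≤ |r| := by
  refine (infDist_le_dist_of_mem hp).trans_eq ?_
  rw [dist_eq_norm, add_sub_cancel_left, norm_smul, hν.norm_eq_one p hp]; simp

section Tube

variable {n : ℕ} {Ω S : Set (EuclideanSpace ℝ (Fin n))}
  {ν : EuclideanSpace ℝ (Fin n) → EuclideanSpace ℝ (Fin n)} {C a : ℝ}

/-- The segment from a nearest point is also normal and shorter than `a`, so injectivity identifies
its foot with `p`. -/
theorem QuadraticBound.nearestPoint_eq (hC : QuadraticBound S ν C)
    (ha : 4 * C * a ≤ 1) (hS : IsHypersurface 2 S) (hSk : IsCompact S)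
    (hν : IsUnitNormalField S ν) {p : 𝔼 n} (hp : p ∈ S) {r : ℝ} (hr : |r| < a) :
    nearestPoint S (p + r • ν p) = p ∧ infDist (p + r • ν p) S = |r| := by
  have hlt := (infDist_add_smul_le hν hp r).trans_lt hr
  obtain ⟨h1, h2⟩ := nearestPoint_spec hSk ⟨p, hp⟩ (p + r • ν p)
  obtain ⟨s, hs, hs'⟩ := eq_add_smul_of_dist_eq_infDist one_le_two hS hν h1 h2
  obtain ⟨h3, rfl⟩ := hC.injective hν ha h1 hp (hs.trans_lt hlt) hr hs'
  exact ⟨h3, hs.symm⟩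

/-- A path off the frontier stays on one side by connectedness. Parameters near 0 decide which, so
`f 0` itself may lie on the frontier. -/
theorem mem_of_segment_avoids_frontier (hΩo : IsOpen Ω) {f : ℝ → 𝔼 n} (hf : Continuous f) {b : ℝ}
    (havoid : ∀ t ∈ Ioo 0 b, f t ∉ frontier Ω) :
    ((∃ᶠ t in 𝓝[>] (0 : ℝ), f t ∈ Ω) → ∀ t ∈ Ioo 0 b, f t ∈ Ω) ∧
    ((∃ᶠ t in 𝓝[>] (0 : ℝ), f t ∉ closure Ω) → ∀ t ∈ Ioo 0 b, f t ∉ closure Ω) := by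
  have hpre : IsPreconnected (f '' Ioo 0 b) := isPreconnected_Ioo.image f hf.continuousOn
  have hcov : f '' Ioo 0 b ⊆ Ω ∪ (closure Ω)ᶜ := by
    rintro _ ⟨t, ht, rfl⟩
    by_contra h
    simp only [mem_union, mem_compl_iff, not_or, not_not] at h
    exact havoid t ht ⟨h.2, by rw [hΩo.interior_eq]; exact h.1⟩
  have hdisj : Disjoint Ω (closure Ω)ᶜ := disjoint_compl_right.mono_left subset_closure
  constructor
  · intro hfr t ht
    have hb : 0 < b := ht.1.trans ht.2
    obtain ⟨s, hs, hsb⟩ := (hfr.and_eventually (Ioo_mem_nhdsGT hb)).exists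
    exact hpre.subset_left_of_subset_union hΩo isClosed_closure.isOpen_compl hdisj hcov
      ⟨f s, mem_image_of_mem f hsb, hs⟩ (mem_image_of_mem f ht)
  · intro hfr t ht
    have hb : 0 < b := ht.1.trans ht.2
    obtain ⟨s, hs, hsb⟩ := (hfr.and_eventually (Ioo_mem_nhdsGT hb)).exists
    exact hpre.subset_right_of_subset_union hΩo isClosed_closure.isOpen_compl hdisj hcov
      ⟨f s, mem_image_of_mem f hsb, hs⟩ (mem_image_of_mem f ht)

/-- The distance to `S` along the normal segment is `|t|`, so the segment meets `S` only at `t = 0`,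
and the outer normal fixes the side for small `t`. -/
theorem QuadraticBound.signedDist_eq (hC : QuadraticBound S ν C)
    (ha : 4 * C * a ≤ 1) (hS : IsHypersurface 2 S) (hSk : IsCompact S)
    (hΩo : IsOpen Ω) (hΩS : frontier Ω = S) (hν : IsOuterUnitNormalField Ω S ν)
    {p : 𝔼 n} (hp : p ∈ S) {r : ℝ} (hr : |r| < a) :
    signedDist Ω S (p + r • ν p) = r := by
  have hinf := fun (t : ℝ) (ht : |t| < a) =>
    (hC.nearestPoint_eq ha hS hSk hν.toIsUnitNormalField hp ht).2
  have havoid : ∀ t : ℝ, |t| < a → t ≠ 0 → p + t • ν p ∉ frontier Ω := by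
    intro t ht ht0 hmem
    rw [hΩS] at hmem
    have := hinf t ht
    rw [infDist_zero_of_mem hmem] at this
    exact ht0 (abs_eq_zero.1 this.symm)
  rw [signedDist, hinf r hr]
  rcases lt_trichotomy r 0 with h | rfl | h
  · have h1 := (mem_of_segment_avoids_frontier hΩo (f := fun t => p + (-t) • ν p)
      (by fun_prop) (b := a) (fun t ht => havoid (-t) (by rw [abs_neg, abs_of_pos ht.1]; exact ht.2)
        (neg_ne_zero.2 ht.1.ne'))).1 (by
          refine Eventually.frequently ?_
          filter_upwards [hν.outer p hp] with t ht
          rw [neg_smul, ← sub_eq_add_neg]; exact ht.2) (-r)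
      ⟨neg_pos.2 h, by rwa [abs_of_neg h] at hr⟩
    simp only [neg_neg] at h1
    rw [if_pos h1, abs_of_neg h, neg_neg]
  · simp
  · have h1 := (mem_of_segment_avoids_frontier hΩo (f := fun t => p + t • ν p)
      (by fun_prop) (b := a) (fun t ht => havoid t (by rw [abs_of_pos ht.1]; exact ht.2)
        ht.1.ne')).2 ((hν.outer p hp).mono fun t ht => ht.1).frequently r
      ⟨h, by rwa [abs_of_pos h] at hr⟩
    rw [if_neg fun h2 => h1 (subset_closure h2), abs_of_pos h]

theorem QuadraticBound.isTube (hC : QuadraticBound S ν C)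
    (ha : 4 * C * a ≤ 1) (hS : IsHypersurface 2 S) (hSk : IsCompact S) (hne : S.Nonempty)
    (hΩo : IsOpen Ω) (hΩS : frontier Ω = S) (hν : IsOuterUnitNormalField Ω S ν) :
    IsTube S ν a (nearestPoint S) (signedDist Ω S) := by
  have hν' := hν.toIsUnitNormalField
  have key : ∀ x, infDist x S < a → ∃ p ∈ S, ∃ r : ℝ, |r| < a ∧ p + r • ν p = x := by
    intro x hx
    obtain ⟨h1, h2⟩ := nearestPoint_spec hSk hne x
    obtain ⟨s, hs, hs'⟩ := eq_add_smul_of_dist_eq_infDist one_le_two hS hν' h1 h2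
    exact ⟨_, h1, s, hs.trans_lt hx, hs'⟩
  have hP := fun p (hp : p ∈ S) (r : ℝ) (hr : |r| < a) =>
    (hC.nearestPoint_eq ha hS hSk hν' hp hr).1
  have hR := fun p (hp : p ∈ S) (r : ℝ) (hr : |r| < a) =>
    hC.signedDist_eq ha hS hSk hΩo hΩS hν hp hr
  refine ⟨fun x _ => (nearestPoint_spec hSk hne x).1, fun x hx => ?_, fun x hx => ?_,
    fun p hp r hr => (infDist_add_smul_le hν' hp r).trans_lt hr, hP, hR⟩
  · obtain ⟨p, hp, r, hr, rfl⟩ := key x hx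
    rwa [hR p hp r hr]
  · obtain ⟨p, hp, r, hr, rfl⟩ := key x hx
    rw [hR p hp r hr, hP p hp r hr]

end Tube

/-! ### Regularity of the tubular coordinates -/

theorem isOpen_infDist_lt {n : ℕ} (S : Set (𝔼 n)) (a : ℝ) : IsOpen {x | infDist x S < a} :=
  isOpen_lt (continuous_infDist_pt S) continuous_const

/-- Bound on the second fundamental form. -/
theorem QuadraticBound.abs_inner_fderiv_le {n : ℕ} {S : Set (𝔼 n)} {ν : 𝔼 n → 𝔼 n} {C : ℝ}
    (hC : QuadraticBound S ν C) {p : 𝔼 n} (hp : p ∈ S) {N : 𝔼 n → 𝔼 n} {N' : 𝔼 n →L[ℝ] 𝔼 n}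
    (hN : HasFDerivAt N N' p) (hNν : ∀ᶠ x in 𝓝 p, x ∈ S → N x = ν x) {v : 𝔼 n}
    (hv : v ∈ tangentVectors S p) : |inner ℝ (N' v) v| ≤ 2 * C * ‖v‖ ^ 2 := by
  obtain ⟨γ, rfl, hγ, hd⟩ := hv
  have h1 : Tendsto (slope (N ∘ γ) 0) (𝓝[≠] 0) (𝓝 (N' v)) :=
    hasDerivAt_iff_tendsto_slope.1 (hN.comp_hasDerivAt 0 hd)
  have h2 : Tendsto (slope γ 0) (𝓝[≠] 0) (𝓝 v) := hasDerivAt_iff_tendsto_slope.1 hd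
  refine le_of_tendsto_of_tendsto (h1.inner h2).abs ((h2.norm.pow 2).const_mul (2 * C)) ?_
  have h3 := hd.continuousAt.tendsto.eventually hNν
  filter_upwards [nhdsWithin_le_nhds hγ, nhdsWithin_le_nhds h3] with t ht ht3
  -- The chord bounds based at the two endpoints add up, whence the factor 2.
  have hb : |inner ℝ (N (γ t) - N (γ 0)) (γ t - γ 0)| ≤ 2 * C * ‖γ t - γ 0‖ ^ 2 := by
    rw [ht3 ht, hNν.self_of_nhds hp, inner_sub_left]
    have e1 := hC _ ht _ hp
    have e2 := hC _ hp _ ht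
    rw [← neg_sub (γ t), inner_neg_right, abs_neg, norm_neg] at e1
    refine (abs_sub _ _).trans ?_
    linarith
  simp only [slope_def_module, Function.comp, real_inner_smul_left, real_inner_smul_right, norm_smul,
    abs_mul, mul_pow, Real.norm_eq_abs]
  calc _ = |(t - 0)⁻¹| ^ 2 * |inner ℝ (N (γ t) - N (γ 0)) (γ t - γ 0)| := by ring
    _ ≤ |(t - 0)⁻¹| ^ 2 * (2 * C * ‖γ t - γ 0‖ ^ 2) := by gcongr
    _ = _ := by ring

/-- The inverse function theorem for the normal map. One derivative is lost because `ν` is only C^k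
on a C^(k+1) surface. -/
theorem IsTube.contDiffOn {n : ℕ} {S : Set (𝔼 n)} {ν : 𝔼 n → 𝔼 n} {C a : ℝ}
    {P : 𝔼 n → 𝔼 n} {R : 𝔼 n → ℝ} (hT : IsTube S ν a P R)
    (hC : QuadraticBound S ν C) (ha : 4 * C * a ≤ 1) {k : WithTop ℕ∞}
    (hk : 1 ≤ k) (hk' : k ≠ ∞) (hS : IsHypersurface (k + 1) S) (hν : IsUnitNormalField S ν) :
    ContDiffOn ℝ k (fun x => (P x, R x)) {x | infDist x S < a} := by
  have hk0 : k ≠ 0 := by rintro rfl; simp at hk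
  have hk1 : k ≤ k + 1 := le_self_add
  intro x₀ hx₀
  refine ContDiffAt.contDiffWithinAt ?_
  have hp := hT.proj_mem x₀ hx₀
  have hr := hT.abs_lt x₀ hx₀
  have hx := hT.add_eq x₀ hx₀
  set p := P x₀
  set r₀ := R x₀
  have ha0 : 0 ≤ a := (abs_nonneg r₀).trans hr.le
  obtain ⟨r, hr0, g, N, hg, hmem, -, hker, hN, hNν⟩ := hS.exists_normal_extension hν hp
  have hpb := mem_ball_self (x := p) hr0
  have hNp := hNν p hpb hp
  have hgp : ContDiffAt ℝ k g p := (hg.contDiffAt (isOpen_ball.mem_nhds hpb)).of_le hk1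
  have hNp' : ContDiffAt ℝ k N p := hN.contDiffAt (isOpen_ball.mem_nhds hpb)
  -- The normal map lives on `S × ℝ`. Adjoining `g` makes it a map between spaces of equal
  -- dimension, and `S × ℝ` is recovered as the preimage of second component 0.
  let F : 𝔼 n × ℝ → 𝔼 n × ℝ := fun z => (z.1 + z.2 • N z.1, g z.1)
  have hfst : ContDiffAt ℝ k (Prod.fst : 𝔼 n × ℝ → 𝔼 n) (p, r₀) := contDiffAt_fst
  have hF : ContDiffAt ℝ k F (p, r₀) :=
    (hfst.add (contDiffAt_snd.smul (ContDiffAt.comp (p, r₀) hNp' hfst))).prodMk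
      (ContDiffAt.comp (p, r₀) hgp hfst)
  have hdN := (hNp'.differentiableAt hk0).hasFDerivAt
  have hdg := (hgp.differentiableAt hk0).hasFDerivAt
  have hf1 : HasFDerivAt (Prod.fst : 𝔼 n × ℝ → 𝔼 n) (ContinuousLinearMap.fst ℝ (𝔼 n) ℝ) (p, r₀) :=
    hasFDerivAt_fst
  have hdF := (hf1.add (hasFDerivAt_snd.smul (hdN.comp (p, r₀) hf1))).prodMk
    (hdg.comp (p, r₀) hf1)
  have hFx : F (p, r₀) = (x₀, 0) := by
    simp only [F, hNp, hx, (hmem p hpb).1 hp]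
  obtain ⟨e, he, hse, V, hVo, hxV, hVt, hV⟩ := exists_contDiffOn_localInverse hk hk' hF (by
    rintro ⟨v, s⟩ hvs
    have hvs' := (DFunLike.congr_fun hdF.fderiv (v, s)).symm.trans hvs
    have h1 : v + (r₀ • fderiv ℝ N p v + s • N p) = 0 := by
      simpa using congrArg Prod.fst hvs'
    have h2 : fderiv ℝ g p v = 0 := by simpa using congrArg Prod.snd hvs'
    have hv := hker p hpb hp v h2
    have h3 := hC.abs_inner_fderiv_le hp hdN
      (eventually_of_mem (isOpen_ball.mem_nhds hpb) hNν) hv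
    -- Pairing the kernel equation with the tangent vector `v` removes the normal term; the
    -- curvature term is at most half of `‖v‖ ^ 2`.
    have h4 : ‖v‖ ^ 2 + r₀ * inner ℝ (fderiv ℝ N p v) v = 0 := by
      have := congrArg (fun w => inner ℝ w v) h1
      simpa [inner_add_left, real_inner_smul_left, hNp, hν.normal p hp v hv,
        real_inner_self_eq_norm_sq] using this
    have h5 : -(r₀ * inner ℝ (fderiv ℝ N p v) v) ≤ a * (2 * C * ‖v‖ ^ 2) := by
      refine (neg_le_abs _).trans ?_
      rw [abs_mul]; gcongr
    have h6 : ‖v‖ ^ 2 ≤ 0 := by nlinarith [sq_nonneg ‖v‖]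
    have h7 : ‖v‖ = 0 := by nlinarith [norm_nonneg v]
    have hv0 : v = 0 := norm_eq_zero.1 h7
    subst hv0
    have h8 : s • ν p = 0 := by simpa [hNp] using h1
    have hne : ν p ≠ 0 := by rw [← norm_ne_zero_iff, hν.norm_eq_one p hp]; exact one_ne_zero
    rw [(smul_eq_zero.1 h8).resolve_right hne]; rfl)
  rw [hFx] at hxV
  have hcd : ContDiffAt ℝ k (fun x => e.symm (x, (0 : ℝ))) x₀ :=
    ContDiffAt.comp x₀ (hV.contDiffAt (hVo.mem_nhds hxV)) (contDiffAt_id.prodMk contDiffAt_const)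
  refine hcd.congr_of_eventuallyEq ?_
  have hex : e.symm (x₀, 0) = (p, r₀) := by rw [← hFx, ← he]; exact e.left_inv hse
  have hc1 : ContinuousAt (fun x => e.symm (x, (0 : ℝ))) x₀ := hcd.continuousAt
  have ev1 : ∀ᶠ x in 𝓝 x₀, (e.symm (x, (0 : ℝ))).1 ∈ ball p r :=
    hc1.fst.eventually (isOpen_ball.mem_nhds (by beta_reduce; rw [hex]; exact hpb))
  have ev2 : ∀ᶠ x in 𝓝 x₀, |(e.symm (x, (0 : ℝ))).2| < a :=
    hc1.snd.abs.eventually (gt_mem_nhds (by beta_reduce; rw [hex]; exact hr))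
  have ev3 : ∀ᶠ x in 𝓝 x₀, (x, (0 : ℝ)) ∈ V :=
    (Continuous.prodMk_left (0 : ℝ)).continuousAt.eventually (hVo.mem_nhds hxV)
  filter_upwards [ev1, ev2, ev3] with x h1 h2 h3
  have h4 := e.right_inv (hVt h3)
  set z := e.symm (x, (0 : ℝ))
  rw [he] at h4
  have h5 : z.1 + z.2 • N z.1 = x := congrArg Prod.fst h4
  have hz : z.1 ∈ S := (hmem _ h1).2 (congrArg Prod.snd h4)
  rw [hNν _ h1 hz] at h5
  rw [← h5, hT.proj_eq _ hz _ h2, hT.height_eq _ hz _ h2]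

theorem IsCkOn.comp_contDiffOn {E F G : Type*} [NormedAddCommGroup E] [NormedSpace ℝ E]
    [NormedAddCommGroup F] [NormedSpace ℝ F] [NormedAddCommGroup G] [NormedSpace ℝ G]
    {k : WithTop ℕ∞} {S : Set E} {f : E → F} (hf : IsCkOn k S f) {U : Set G} (hU : IsOpen U)
    {P : G → E} (hP : ContDiffOn ℝ k P U) (hPU : MapsTo P U S) :
    ContDiffOn ℝ k (fun x => f (P x)) U := by
  intro x hx
  refine ContDiffAt.contDiffWithinAt ?_
  obtain ⟨V, hVo, hxV, g, hg, hfg⟩ := hf (P x) (hPU hx)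
  have hPx := hP.contDiffAt (hU.mem_nhds hx)
  refine ((hg.contDiffAt (hVo.mem_nhds hxV)).comp x hPx).congr_of_eventuallyEq ?_
  filter_upwards [hU.mem_nhds hx, hPx.continuousAt.eventually (hVo.mem_nhds hxV)] with y hy hyV
  exact hfg ⟨hPU hy, hyV⟩

/-! ### Γ as a graph over Σ -/

section Graph

variable {n : ℕ} {S Γ : Set (EuclideanSpace ℝ (Fin n))}
  {ν νΓ : EuclideanSpace ℝ (Fin n) → EuclideanSpace ℝ (Fin n)} {a : ℝ}
  {P : EuclideanSpace ℝ (Fin n) → EuclideanSpace ℝ (Fin n)} {R : EuclideanSpace ℝ (Fin n) → ℝ}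
  {k : WithTop ℕ∞}

/-- `σ` is a `C^k` section of the projection `P : Γ → S` near `P q`, with value `q` there. -/
structure IsLocalSection (k : WithTop ℕ∞) (S Γ : Set (𝔼 n)) (P : 𝔼 n → 𝔼 n) (q : 𝔼 n)
    (V : Set (𝔼 n)) (σ : 𝔼 n → 𝔼 n) : Prop where
  isOpen : IsOpen V
  proj_mem : P q ∈ V
  contDiffOn : ContDiffOn ℝ k σ V
  section_proj : σ (P q) = q
  mem : ∀ p ∈ S, p ∈ V → σ p ∈ Γ
  proj_section : ∀ p ∈ S, p ∈ V → P (σ p) = p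

/-- A hypersurface transversal to the normal direction of `S` is locally a graph over `S`. -/
theorem IsTube.exists_isLocalSection (hT : IsTube S ν a P R)
    (hk : 1 ≤ k) (hk' : k ≠ ∞) (hPR : ContDiffOn ℝ k (fun x => (P x, R x)) {x | infDist x S < a})
    (hνk : IsCkOn k S ν) (hν : IsUnitNormalField S ν) (hΓ : IsHypersurface k Γ)
    (hνΓ : IsUnitNormalField Γ νΓ) {q : 𝔼 n} (hqΓ : q ∈ Γ) (hq : infDist q S < a)
    (hne : inner ℝ (νΓ q) (ν (P q)) ≠ (0 : ℝ)) :
    (∃ V σ, IsLocalSection k S Γ P q V σ) ∧ ∃ W ∈ 𝓝 q, InjOn P (Γ ∩ W) := by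
  have hk0 : k ≠ 0 := by rintro rfl; simp at hk
  have hUo := isOpen_infDist_lt S a
  have hUq : {x | infDist x S < a} ∈ 𝓝 q := hUo.mem_nhds hq
  have hP : ContDiffOn ℝ k P {x | infDist x S < a} := hPR.fst
  have hR : ContDiffOn ℝ k R {x | infDist x S < a} := hPR.snd
  have hνP : ContDiffOn ℝ k (fun x => ν (P x)) {x | infDist x S < a} :=
    hνk.comp_contDiffOn hUo hP hT.proj_mem
  have hpS := hT.proj_mem q hq
  obtain ⟨r, hr, g, hg, hmem, hw, hker⟩ := hΓ.exists_definingFunction hk hqΓ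
  have hqb := mem_ball_self (x := q) hr
  obtain ⟨hc0, hc⟩ := exists_smul_normal hνΓ hqΓ (hw q hqb) (hker q hqb hqΓ)
  have hgq : g q = 0 := (hmem q hqb).1 hqΓ
  have hPa := hP.contDiffAt hUq
  have hRa := hR.contDiffAt hUq
  have hνPa := hνP.contDiffAt hUq
  have hga := hg.contDiffAt (isOpen_ball.mem_nhds hqb)
  have hdP := (hPa.differentiableAt hk0).hasFDerivAt
  have hdR := (hRa.differentiableAt hk0).hasFDerivAt
  have hdν := (hνPa.differentiableAt hk0).hasFDerivAt
  have hdg := (hga.differentiableAt hk0).hasFDerivAt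
  have htan : ∀ v, inner ℝ (ν (P q)) (fderiv ℝ P q v) = (0 : ℝ) := fun v => by
    have hl : HasDerivAt (fun t : ℝ => q + t • v) v 0 := by
      simpa using ((hasDerivAt_id (0 : ℝ)).smul_const v).const_add q
    refine hν.normal _ hpS _ ⟨fun t => P (q + t • v), by simp, ?_, ?_⟩
    · have hc : Tendsto (fun t : ℝ => q + t • v) (𝓝 0) (𝓝 q) := by
        simpa using hl.continuousAt.tendsto
      filter_upwards [hc.eventually hUq] with t ht using hT.proj_mem _ ht
    · have h0 : HasFDerivAt P (fderiv ℝ P q) (q + (0 : ℝ) • v) := by simpa using hdP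
      exact h0.comp_hasDerivAt (0 : ℝ) hl
  -- Differentiating `x = P x + R x • ν (P x)` shows that only normal directions are killed by `DP`.
  have hkerP : ∀ v, fderiv ℝ P q v = 0 → v = fderiv ℝ R q v • ν (P q) := fun v hv => by
    have h1 : fderiv ℝ (fun x => ν (P x)) q v = 0 := by
      obtain ⟨V, hVo, hpV, N, hN, hNν⟩ := hνk (P q) hpS
      have h2 : (fun x => ν (P x)) =ᶠ[𝓝 q] N ∘ P := by
        filter_upwards [hUq, hPa.continuousAt.eventually (hVo.mem_nhds hpV)] with y hy hyV
        exact hNν ⟨hT.proj_mem y hy, hyV⟩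
      have hdN := ((hN.contDiffAt (hVo.mem_nhds hpV)).differentiableAt hk0).hasFDerivAt
      rw [h2.fderiv_eq, (hdN.comp q hdP).fderiv]
      simp [hv]
    have h3 : (fun x => P x + R x • ν (P x)) =ᶠ[𝓝 q] id := by
      filter_upwards [hUq] with y hy using hT.add_eq y hy
    have h4 := ((hdP.add (hdR.smul hdν)).congr_of_eventuallyEq h3.symm).unique (hasFDerivAt_id q)
    have h5 := DFunLike.congr_fun h4 v
    simpa [hv, h1] using h5.symm
  -- Replacing the height `R` by the defining function `g` of Γ flattens Γ onto `S`, where `G = P`;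
  -- the inverse of `G` restricted to `S` is the section.
  let G : 𝔼 n → 𝔼 n := fun x => P x + g x • ν (P x)
  have hG : ContDiffAt ℝ k G q := hPa.add (hga.smul hνPa)
  have hdG := hdP.add (hdg.smul hdν)
  have hGq : G q = P q := by simp [G, hgq]
  obtain ⟨e, he, hse, V, hVo, hqV, hVt, hV⟩ := exists_contDiffOn_localInverse hk hk' hG (by
    -- The normal part of the kernel equation gives `Dg v = 0`, the rest `DP v = 0`. So `v` is
    -- normal to `S`, and transversality forces it to vanish.
    intro v hv
    have hv' : fderiv ℝ P q v + fderiv ℝ g q v • ν (P q) = 0 := by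
      have := (DFunLike.congr_fun hdG.fderiv v).symm.trans hv
      simpa [hgq] using this
    have h1 : fderiv ℝ g q v = 0 := by
      have := congrArg (fun w => inner ℝ (ν (P q)) w) hv'
      simpa [inner_add_right, inner_smul_right, htan, real_inner_self_eq_norm_sq,
        hν.norm_eq_one _ hpS] using this
    have h2 : fderiv ℝ P q v = 0 := by simpa [h1] using hv'
    have h3 := hkerP v h2
    have h4 : fderiv ℝ R q v = 0 := by
      rw [hc, h3, inner_smul_right] at h1
      simpa [hc0, hne] using h1
    rw [h3, h4, zero_smul])
  rw [hGq] at hqV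
  have heq : e.symm (P q) = q := by rw [← hGq, ← he]; exact e.left_inv hse
  have hcont : ContinuousOn e.symm V := hV.continuousOn
  constructor
  · let W : Set (𝔼 n) := ball q r ∩ {x | infDist x S < a} ∩ {x | x ∈ ball q r ∧ |g x| < a}
    have hWo : IsOpen W := by
      refine (isOpen_ball.inter hUo).inter ?_
      have : ContinuousOn (fun x => |g x|) (ball q r) := hg.continuousOn.abs
      exact this.isOpen_inter_preimage isOpen_ball isOpen_Iio
    have ha : 0 < a := infDist_nonneg.trans_lt hq
    have hqW : q ∈ W := ⟨⟨hqb, hq⟩, hqb, by simpa [hgq] using ha⟩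
    -- Both `(P x, g x)` and `(p, 0)` are tubular coordinates of `p`; `|g x| < a` makes them
    -- comparable.
    have key : ∀ p ∈ S, p ∈ V ∩ e.symm ⁻¹' W → P (e.symm p) = p ∧ g (e.symm p) = 0 := by
      rintro p hp ⟨hpV, ⟨-, hU⟩, -, hgx⟩
      have h1 := e.right_inv (hVt hpV)
      rw [he] at h1
      have hPx := hT.proj_mem _ hU
      refine ⟨?_, ?_⟩
      · have h2 := hT.proj_eq _ hPx _ hgx
        have h3 := hT.proj_eq p hp 0 (by simpa using ha)
        rw [zero_smul, add_zero] at h3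
        rw [← h2, ← h3]; congr 1
        simpa [h3] using h1
      · have h2 := hT.height_eq _ hPx _ hgx
        have h3 := hT.height_eq p hp 0 (by simpa using ha)
        rw [zero_smul, add_zero] at h3
        rw [← h2, ← h3]; congr 1
    exact ⟨V ∩ e.symm ⁻¹' W, e.symm, hcont.isOpen_inter_preimage hVo hWo,
      ⟨hqV, by rw [mem_preimage, heq]; exact hqW⟩, hV.mono inter_subset_left, heq,
      fun p hp hpV => (hmem _ hpV.2.1.1).2 (key p hp hpV).2, fun p hp hpV => (key p hp hpV).1⟩
  · refine ⟨e.source ∩ ball q r, inter_mem (e.open_source.mem_nhds hse)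
      (isOpen_ball.mem_nhds hqb), ?_⟩
    rintro x ⟨hxΓ, hxe, hxb⟩ y ⟨hyΓ, hye, hyb⟩ hxy
    refine e.injOn hxe hye ?_
    rw [he]
    simp [G, (hmem x hxb).1 hxΓ, (hmem y hyb).1 hyΓ, hxy]

/-- A compact connected `Γ` in the tube that is everywhere locally a graph over the connected
set `S` projects bijectively to `S`. -/
theorem IsTube.bijOn_proj (hT : IsTube S ν a P R)
    (hPR : ContinuousOn (fun x => (P x, R x)) {x | infDist x S < a})
    (hS : IsPreconnected S) (hΓk : IsCompact Γ) (hΓc : IsConnected Γ)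
    (hΓU : ∀ q ∈ Γ, infDist q S < a) (hsec : ∀ q ∈ Γ, ∃ V σ, IsLocalSection k S Γ P q V σ)
    (hinj : ∀ q ∈ Γ, ∃ W ∈ 𝓝 q, InjOn P (Γ ∩ W)) : BijOn P Γ S := by
  have hUo := isOpen_infDist_lt S a
  have hPc : ∀ q ∈ Γ, ContinuousAt P q := fun q hq =>
    (hPR.continuousAt (hUo.mem_nhds (hΓU q hq))).fst
  have hRc : ∀ q ∈ Γ, ContinuousAt R q := fun q hq =>
    (hPR.continuousAt (hUo.mem_nhds (hΓU q hq))).snd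
  have hmaps : MapsTo P Γ S := fun q hq => hT.proj_mem q (hΓU q hq)
  have hPΓ : ContinuousOn P Γ := fun q hq => (hPc q hq).continuousWithinAt
  have hRΓ : ContinuousOn R Γ := fun q hq => (hRc q hq).continuousWithinAt
  obtain ⟨q₀, hq₀⟩ := hΓc.nonempty
  have hsurj : SurjOn P Γ S := by
    choose! V σ hσ using hsec
    let u : Set (𝔼 n) := ⋃ q ∈ Γ, V q
    have huo : IsOpen u := isOpen_biUnion fun q hq => (hσ q hq).isOpen
    have huS : S ∩ u ⊆ P '' Γ := by
      rintro p ⟨hp, hpu⟩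
      obtain ⟨q, hq, hpV⟩ := mem_iUnion₂.1 hpu
      exact ⟨σ q p, (hσ q hq).mem p hp hpV, (hσ q hq).proj_section p hp hpV⟩
    have hvo : IsOpen (P '' Γ)ᶜ := (hΓk.image_of_continuousOn hPΓ).isClosed.isOpen_compl
    have hPu : P '' Γ ⊆ u := by
      rintro _ ⟨q, hq, rfl⟩
      exact mem_biUnion hq (hσ q hq).proj_mem
    have h1 : S ⊆ u := by
      rcases isPreconnected_iff_subset_of_disjoint.1 hS u (P '' Γ)ᶜ huo hvo
        (fun p _ => (em (p ∈ P '' Γ)).imp (fun h => hPu h) id)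
        (by
          ext p
          simp only [mem_inter_iff, mem_empty_iff_false, iff_false]
          rintro ⟨hp, hpu, hpv⟩
          exact hpv (huS ⟨hp, hpu⟩)) with h | h
      · exact h
      · exact absurd ⟨q₀, hq₀, rfl⟩ (h (hmaps hq₀))
    exact fun p hp => huS ⟨hp, h1 hp⟩
  -- The lowest sheet: points of least height in their fibre.
  let Γ₁ : Set (𝔼 n) := {q | q ∈ Γ ∧ ∀ q' ∈ Γ, P q' = P q → R q ≤ R q'}
  have hcl₁ : IsClosed Γ₁ := by
    refine IsSeqClosed.isClosed fun u q hu huq => ?_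
    have hq : q ∈ Γ := hΓk.isClosed.mem_of_tendsto huq (Eventually.of_forall fun m => (hu m).1)
    refine ⟨hq, fun q' hq' hP => ?_⟩
    -- The section through a competitor `q'` moves it into the fibres of the approximating points,
    -- where minimality is known.
    obtain ⟨V, σ, hσ⟩ := hsec q' hq'
    have h1 : Tendsto (fun m => P (u m)) atTop (𝓝 (P q')) := by
      rw [hP]; exact (hPc q hq).tendsto.comp huq
    have h2 : Tendsto (fun m => σ (P (u m))) atTop (𝓝 q') := by
      have := (hσ.contDiffOn.continuousOn.continuousAt (hσ.isOpen.mem_nhds hσ.proj_mem)).tendsto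
      rw [hσ.section_proj] at this
      exact this.comp h1
    refine le_of_tendsto_of_tendsto ((hRc q hq).tendsto.comp huq)
      ((hRc q' hq').tendsto.comp h2) ?_
    filter_upwards [h1.eventually (hσ.isOpen.mem_nhds hσ.proj_mem)] with m hm
    have hmS := hmaps (hu m).1
    exact (hu m).2 _ (hσ.mem _ hmS hm) (hσ.proj_section _ hmS hm)
  have hcl₂ : IsClosed (Γ \ Γ₁) := by
    refine IsSeqClosed.isClosed fun u q hu huq => ?_
    have hq : q ∈ Γ := hΓk.isClosed.mem_of_tendsto huq (Eventually.of_forall fun m => (hu m).1)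
    refine ⟨hq, fun hq1 => ?_⟩
    have hex : ∀ m, ∃ q' ∈ Γ, P q' = P (u m) ∧ R q' < R (u m) := fun m => by
      by_contra! hcon
      exact (hu m).2 ⟨(hu m).1, hcon⟩
    choose w hwΓ hwP hwR using hex
    obtain ⟨q', hq', φ, hφ, hwq⟩ := hΓk.tendsto_subseq hwΓ
    have huq' := huq.comp hφ.tendsto_atTop
    have hPq : P q' = P q := by
      refine tendsto_nhds_unique ((hPc q' hq').tendsto.comp hwq)
        (((hPc q hq).tendsto.comp huq').congr fun m => ?_)
      exact (hwP (φ m)).symm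
    -- Lower competitors converge to a point of the same fibre, no higher than the minimal `q`,
    -- hence to `q`. This contradicts injectivity of `P` near `q`.
    have hRq : R q' = R q := by
      refine le_antisymm ?_ (hq1.2 q' hq' hPq)
      exact le_of_tendsto_of_tendsto' ((hRc q' hq').tendsto.comp hwq)
        ((hRc q hq).tendsto.comp huq') fun m => (hwR (φ m)).le
    have hqq : q' = q := by
      rw [← hT.add_eq q' (hΓU q' hq'), ← hT.add_eq q (hΓU q hq), hPq, hRq]
    subst hqq
    obtain ⟨W, hW, hWinj⟩ := hinj q' hq'
    obtain ⟨m, hm1, hm2⟩ := ((hwq.eventually hW).and (huq'.eventually hW)).exists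
    have := hWinj ⟨hwΓ _, hm1⟩ ⟨(hu _).1, hm2⟩ (hwP _)
    exact (hwR (φ m)).ne (congrArg R this)
  have hne₁ : (Γ ∩ Γ₁).Nonempty := by
    have hfib : IsCompact (Γ ∩ P ⁻¹' {P q₀}) :=
      hΓk.of_isClosed_subset (hPΓ.preimage_isClosed_of_isClosed hΓk.isClosed isClosed_singleton)
        inter_subset_left
    obtain ⟨q, ⟨hq, hqP⟩, hmin⟩ := hfib.exists_isMinOn ⟨q₀, hq₀, rfl⟩
      (hRΓ.mono inter_subset_left)
    exact ⟨q, hq, hq, fun q' hq' h => hmin ⟨hq', h.trans hqP⟩⟩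
  have hall : Γ ⊆ Γ₁ := by
    intro q hq
    by_contra hcon
    obtain ⟨z, -, hz1, hz2⟩ := isPreconnected_closed_iff.1 hΓc.isPreconnected Γ₁ (Γ \ Γ₁) hcl₁ hcl₂
      (fun x hx => (em (x ∈ Γ₁)).imp id fun h => ⟨hx, h⟩) hne₁ ⟨q, hq, hq, hcon⟩
    exact hz2.2 hz1
  refine ⟨hmaps, fun q hq q' hq' hP => ?_, hsurj⟩
  have hRq : R q = R q' := le_antisymm ((hall hq).2 q' hq' hP.symm) ((hall hq').2 q hq hP)
  rw [← hT.add_eq q' (hΓU q' hq'), ← hT.add_eq q (hΓU q hq), hP, hRq]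

/-- Local sections of class `C^k` make the graph function and the graph map of class `C^k`. -/
theorem IsTube.isCkOn_graph (hT : IsTube S ν a P R)
    (hPR : ContDiffOn ℝ k (fun x => (P x, R x)) {x | infDist x S < a})
    (hΓU : ∀ q ∈ Γ, infDist q S < a) (hbij : BijOn P Γ S) {ρ : 𝔼 n → ℝ}
    (hρ : ∀ q ∈ Γ, ρ (P q) = R q) (hsec : ∀ q ∈ Γ, ∃ V σ, IsLocalSection k S Γ P q V σ) :
    IsCkOn k S ρ ∧ IsCkDiffeo k S Γ (fun p => p + ρ p • ν p) := by
  have hUo := isOpen_infDist_lt S a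
  have hgraph : ∀ q ∈ Γ, P q + ρ (P q) • ν (P q) = q := fun q hq => by
    rw [hρ q hq, hT.add_eq q (hΓU q hq)]
  refine ⟨fun p hp => ?_, fun p hp => ?_, fun p hp => ?_, P, fun q hq => ?_, hbij.mapsTo, ?_, ?_⟩
  · obtain ⟨q, hq, rfl⟩ := hbij.surjOn hp
    obtain ⟨V, σ, hσ⟩ := hsec q hq
    refine ⟨V ∩ σ ⁻¹' {x | infDist x S < a},
      hσ.contDiffOn.continuousOn.isOpen_inter_preimage hσ.isOpen hUo,
      ⟨hσ.proj_mem, by rw [mem_preimage, hσ.section_proj]; exact hΓU q hq⟩, fun p => R (σ p),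
      ContDiffOn.comp hPR.snd (hσ.contDiffOn.mono inter_subset_left) fun x hx => hx.2, ?_⟩
    rintro p' ⟨hp', hpV, -⟩
    have := hρ _ (hσ.mem p' hp' hpV)
    rwa [hσ.proj_section p' hp' hpV] at this
  · obtain ⟨q, hq, rfl⟩ := hbij.surjOn hp
    obtain ⟨V, σ, hσ⟩ := hsec q hq
    refine ⟨V, hσ.isOpen, hσ.proj_mem, σ, hσ.contDiffOn, ?_⟩
    rintro p' ⟨hp', hpV⟩
    have := hgraph _ (hσ.mem p' hp' hpV)
    rwa [hσ.proj_section p' hp' hpV] at this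
  · obtain ⟨q, hq, rfl⟩ := hbij.surjOn hp
    beta_reduce
    rwa [hgraph q hq]
  · exact ⟨_, hUo, hΓU q hq, P, hPR.fst, fun _ _ => rfl⟩
  · intro p hp
    obtain ⟨q, hq, rfl⟩ := hbij.surjOn hp
    beta_reduce
    rw [hgraph q hq]
  · exact hgraph

end Graph

/-! ### The level function -/

theorem abs_signedDist {n : ℕ} (Ω S : Set (𝔼 n)) (x : 𝔼 n) :
    |signedDist Ω S x| = infDist x S := by
  rw [signedDist]
  split_ifs
  · rw [abs_neg, abs_of_nonneg infDist_nonneg]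
  · exact abs_of_nonneg infDist_nonneg

theorem exists_isCutoff : ∃ χ : ℝ → ℝ, IsCutoff χ := by
  let f : ContDiffBump (0 : ℝ) := ⟨1, 2, one_pos, one_lt_two⟩
  refine ⟨f, f.contDiff, fun s hs => f.one_of_mem_closedBall ?_, fun s hs => ?_,
    fun s => f.nonneg, fun s => f.le_one⟩
  · simpa [f] using hs
  · exact f.zero_of_le_dist (by simpa [f] using hs)

/-- The profile of the canonical level function is of class `C¹`. -/
theorem IsCutoff.contDiff_profile {χ : ℝ → ℝ} (hχ : IsCutoff χ) (a : ℝ) :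
    ContDiff ℝ 1 fun t : ℝ => t * χ (3 * t / a) + Real.sign t * (1 - χ (3 * t / a)) := by
  have hχ1 : ContDiff ℝ 1 (fun t : ℝ => χ (3 * t / a)) :=
    (hχ.smooth.of_le (by exact_mod_cast le_top)).comp
      ((contDiff_const.mul contDiff_id).div_const a)
  have hconst : ∀ c : ℝ, ContDiff ℝ 1 fun t : ℝ => t * χ (3 * t / a) + c * (1 - χ (3 * t / a)) :=
    fun c => (contDiff_id.mul hχ1).add (contDiff_const.mul (contDiff_const.sub hχ1))
  refine contDiff_iff_contDiffAt.2 fun t => ?_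
  rcases lt_trichotomy t 0 with h | rfl | h
  · refine (hconst (-1)).contDiffAt.congr_of_eventuallyEq ?_
    filter_upwards [gt_mem_nhds h] with s hs
    rw [Real.sign_of_neg hs]
  -- The jump of the sign at 0 is invisible, since `1 - χ` vanishes near 0.
  · refine contDiffAt_id.congr_of_eventuallyEq ?_
    have h1 : ∀ᶠ s : ℝ in 𝓝 0, |3 * s / a| < 1 := by
      have : ContinuousAt (fun s : ℝ => |3 * s / a|) 0 := by fun_prop
      exact this.eventually (gt_mem_nhds (by simp))
    filter_upwards [h1] with s hs
    simp [hχ.eq_one _ hs.le]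
  · refine (hconst 1).contDiffAt.congr_of_eventuallyEq ?_
    filter_upwards [lt_mem_nhds h] with s hs
    rw [Real.sign_of_pos hs]

/-- Where `|d| < a / 3` the function is `d - ρ ∘ P`, with slope 1 along normals. Elsewhere it
averages `d - ρ ∘ P` and `sign d` with weights `χ` and `1 - χ`; both have the sign of `d`, as `|ρ| <
ε ≤ a / 3 ≤ |d|`. Off the tube it is locally constant. -/
theorem isC1LevelFunction {n : ℕ} {Ω S Γ : Set (𝔼 n)} {ν : 𝔼 n → 𝔼 n} {a ε : ℝ} {ρ : 𝔼 n → ℝ}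
    (hT : IsTube S ν a (nearestPoint S) (signedDist Ω S)) (ha : 0 < a)
    (hPR : ContDiffOn ℝ 1 (fun x => (nearestPoint S x, signedDist Ω S x)) {x | infDist x S < a})
    (hΩo : IsOpen Ω) (hΩS : frontier Ω = S) (hSk : IsCompact S) (hne : S.Nonempty)
    (hν : IsUnitNormalField S ν)
    (hε : ε ≤ a / 3) (hρ : IsCkOn 1 S ρ) (hρε : ∀ p ∈ S, |ρ p| < ε)
    (hΓε : ∀ q ∈ Γ, infDist q S < ε)
    (hΓ : ∀ x, infDist x S < a → (x ∈ Γ ↔ signedDist Ω S x = ρ (nearestPoint S x)))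
    {χ : ℝ → ℝ} (hχ : IsCutoff χ) :
    IsC1LevelFunction Γ (fun x => canonicalLevel Ω S a χ x -
      ρ (nearestPoint S x) * χ (3 * signedDist Ω S x / a)) := by
  have hUo := isOpen_infDist_lt S a
  have habs := abs_signedDist Ω S
  have hone : ∀ x, infDist x S < a / 3 → χ (3 * signedDist Ω S x / a) = 1 := fun x hx => by
    refine hχ.eq_one _ ?_
    rw [abs_div, abs_mul, habs, abs_of_pos ha, div_le_one ha, abs_of_pos three_pos]
    linarith
  have hnear : ∀ x, infDist x S < a / 3 → canonicalLevel Ω S a χ x -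
      ρ (nearestPoint S x) * χ (3 * signedDist Ω S x / a) =
      signedDist Ω S x - ρ (nearestPoint S x) := fun x hx => by
    rw [canonicalLevel, hone x hx]; ring
  have hcd : ContDiff ℝ 1 (fun x => canonicalLevel Ω S a χ x -
      ρ (nearestPoint S x) * χ (3 * signedDist Ω S x / a)) := by
    refine contDiff_iff_contDiffAt.2 fun x => ?_
    rcases lt_or_ge (infDist x S) a with hx | hx
    · have hxU := hUo.mem_nhds hx
      have hR : ContDiffAt ℝ 1 (signedDist Ω S) x := (hPR.contDiffAt hxU).snd
      have hρP : ContDiffAt ℝ 1 (fun x => ρ (nearestPoint S x)) x :=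
        (hρ.comp_contDiffOn hUo hPR.fst hT.proj_mem).contDiffAt hxU
      have hχR : ContDiffAt ℝ 1 (fun x => χ (3 * signedDist Ω S x / a)) x :=
        ContDiffAt.comp x (hχ.smooth.of_le (by exact_mod_cast le_top)).contDiffAt
          ((contDiffAt_const.mul hR).div_const a)
      exact (ContDiffAt.comp x (hχ.contDiff_profile a).contDiffAt hR).sub (hρP.mul hχR)
    · have hfar : ∀ᶠ y in 𝓝 x, 2 * a / 3 < infDist y S :=
        (continuous_infDist_pt S).continuousAt.eventually (lt_mem_nhds (by linarith))
      have hval : ∀ y, 2 * a / 3 < infDist y S → canonicalLevel Ω S a χ y -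
          ρ (nearestPoint S y) * χ (3 * signedDist Ω S y / a) =
          Real.sign (signedDist Ω S y) := fun y hy => by
        have h0 : χ (3 * signedDist Ω S y / a) = 0 := by
          refine hχ.eq_zero _ ?_
          rw [abs_div, abs_mul, habs, abs_of_pos ha, le_div_iff₀ ha, abs_of_pos three_pos]
          linarith
        rw [canonicalLevel, h0]; ring
      by_cases hxΩ : x ∈ Ω
      · refine (contDiffAt_const (c := (-1 : ℝ))).congr_of_eventuallyEq ?_
        filter_upwards [hfar, hΩo.mem_nhds hxΩ] with y hy hyΩ
        rw [hval y hy, signedDist, if_pos hyΩ, Real.sign_of_neg (by linarith)]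
      · have hxc : x ∉ closure Ω := fun hc => by
          have hxS : x ∈ S := by
            rw [← hΩS, frontier, hΩo.interior_eq]; exact ⟨hc, hxΩ⟩
          rw [infDist_zero_of_mem hxS] at hx
          linarith
        refine (contDiffAt_const (c := (1 : ℝ))).congr_of_eventuallyEq ?_
        filter_upwards [hfar, isClosed_closure.isOpen_compl.mem_nhds hxc] with y hy hyΩ
        rw [hval y hy, signedDist, if_neg fun h => hyΩ (subset_closure h),
          Real.sign_of_pos (by linarith)]
  refine ⟨hcd, ?_, fun x hx h0 => ?_⟩
  · ext x
    rw [mem_preimage, mem_singleton_iff]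
    rcases lt_or_ge (infDist x S) (a / 3) with hx | hx
    · rw [hnear x hx, sub_eq_zero, hΓ x (by linarith)]
    · refine iff_of_false (fun h => ?_) fun h => by linarith [hΓε x h]
      have h1 := abs_lt.1 (hρε _ (nearestPoint_spec hSk hne x).1)
      have h2 := hχ.nonneg (3 * signedDist Ω S x / a)
      have h3 := hχ.le_one (3 * signedDist Ω S x / a)
      rw [canonicalLevel] at h
      rw [← habs] at hx
      set d := signedDist Ω S x
      set c := χ (3 * d / a)
      have hpos : 0 < c ∨ c = 0 := h2.lt_or_eq.imp id Eq.symm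
      rcases le_abs.1 hx with hd | hd
      · rw [Real.sign_of_pos (by linarith)] at h
        rcases hpos with hc | hc
        · have : 0 < (d - ρ (nearestPoint S x)) * c := mul_pos (by linarith) hc
          linarith
        · rw [hc] at h; linarith
      · rw [Real.sign_of_neg (by linarith)] at h
        rcases hpos with hc | hc
        · have : 0 < (-d + ρ (nearestPoint S x)) * c := mul_pos (by linarith) hc
          linarith
        · rw [hc] at h; linarith
  · have hxε := hΓε x hx
    have hxa : infDist x S < a := by linarith
    have hpS := hT.proj_mem x hxa
    have hxeq := hT.add_eq x hxa
    have hR : |signedDist Ω S x| < a / 3 := by rw [habs]; linarith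
    set p := nearestPoint S x with hp
    set r := signedDist Ω S x with hr
    have hl : HasDerivAt (fun t : ℝ => x + t • ν p) (ν p) 0 := by
      simpa using ((hasDerivAt_id (0 : ℝ)).smul_const (ν p)).const_add x
    have hψ := (hcd.differentiable one_ne_zero (x + (0 : ℝ) • ν p)).hasFDerivAt
    have h1 := hψ.comp_hasDerivAt (0 : ℝ) hl
    rw [zero_smul, add_zero, h0] at h1
    have h2 : HasDerivAt (fun t : ℝ => r + t - ρ p) 1 0 :=
      ((hasDerivAt_id (0 : ℝ)).const_add r).sub_const (ρ p)
    have h3 : ∀ᶠ t : ℝ in 𝓝 0, |r + t| < a / 3 := by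
      have : ContinuousAt (fun t : ℝ => |r + t|) 0 := by fun_prop
      exact this.eventually (gt_mem_nhds (by simpa using hR))
    have h4 := h2.unique (h1.congr_of_eventuallyEq ?_)
    · simp at h4
    · filter_upwards [h3] with t ht
      have hta : |r + t| < a := by linarith
      have hxt : x + t • ν p = p + (r + t) • ν p := by
        rw [add_smul, ← add_assoc, hxeq]
      rw [Function.comp_apply, hxt, hnear, hT.height_eq p hpS _ hta, hT.proj_eq p hpS _ hta]
      exact (infDist_add_smul_le hν hpS _).trans_lt ht

/-! ### Tubular width and C¹-closeness -/

theorem isTubularWidth {n : ℕ} {S : Set (𝔼 n)} {ν : 𝔼 n → 𝔼 n} {a : ℝ}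
    {P : 𝔼 n → 𝔼 n} {R : 𝔼 n → ℝ} (hT : IsTube S ν a P R)
    (hPR : ContDiffOn ℝ 1 (fun x => (P x, R x)) {x | infDist x S < a}) (hν : IsCkOn 1 S ν) :
    IsTubularWidth S ν a := by
  refine ⟨?_, ?_, fun x => (P x, R x), ?_, ?_, ?_, ?_⟩
  · rintro ⟨p, r⟩ ⟨hp, -⟩
    obtain ⟨U, hUo, hpU, N, hN, hNν⟩ := hν p hp
    have hN' : ContDiffOn ℝ 1 (fun z : 𝔼 n × ℝ => N z.1) (U ×ˢ univ) :=
      hN.comp contDiffOn_fst fun z hz => hz.1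
    refine ⟨U ×ˢ univ, hUo.prod isOpen_univ, ⟨hpU, trivial⟩, fun z => z.1 + z.2 • N z.1,
      contDiffOn_fst.add (contDiffOn_snd.smul hN'), ?_⟩
    rintro ⟨p', r'⟩ ⟨⟨hp', -⟩, hpU', -⟩
    simp only [hNν ⟨hp', hpU'⟩]
  · rintro ⟨p, r⟩ ⟨hp, hr⟩
    exact hT.infDist_lt p hp r (abs_lt.2 hr)
  · exact fun x hx => ⟨_, isOpen_infDist_lt S a, hx, _, hPR, fun _ _ => rfl⟩
  · exact fun x hx => ⟨hT.proj_mem x hx, abs_lt.1 (hT.abs_lt x hx)⟩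
  · rintro ⟨p, r⟩ ⟨hp, hr⟩
    exact Prod.ext (hT.proj_eq p hp r (abs_lt.2 hr)) (hT.height_eq p hp r (abs_lt.2 hr))
  · exact hT.add_eq

theorem C1Close.exists_near {n : ℕ} {S Γ : Set (𝔼 n)} {ν νΓ : 𝔼 n → 𝔼 n} {ε : ℝ}
    (h : C1Close ε Γ νΓ S ν) (hSk : IsCompact S) (hΓk : IsCompact Γ) (hS : S.Nonempty)
    (hν : IsUnitNormalField S ν) (hνΓ : IsUnitNormalField Γ νΓ) {q : 𝔼 n} (hq : q ∈ Γ) :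
    ∃ p ∈ S, dist q p < ε ∧ dist (νΓ q) (ν p) < ε := by
  have hbdd : ∀ (A : Set (𝔼 n)) (μ : 𝔼 n → 𝔼 n), IsCompact A → IsUnitNormalField A μ →
      Bornology.IsBounded (normalBundle A μ) := fun A μ hA hμ =>
    (hA.image_of_continuousOn ((WithLp.prod_continuous_toLp 2 _ _).comp_continuousOn
      (continuousOn_id.prodMk hμ.continuousOn))).isBounded
  -- `hausdorffDist` takes the default value 0 at infinite distance; compactness excludes this.
  have hfin := hausdorffEDist_ne_top_of_nonempty_of_bounded (s := normalBundle Γ νΓ)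
    (t := normalBundle S ν) (Nonempty.image _ ⟨q, hq⟩) (hS.image _)
    (hbdd Γ νΓ hΓk hνΓ) (hbdd S ν hSk hν)
  obtain ⟨_, ⟨p, hp, rfl⟩, hlt⟩ :=
    exists_dist_lt_of_hausdorffDist_lt (mem_image_of_mem _ hq) h hfin
  rw [WithLp.prod_dist_eq_of_L2] at hlt
  refine ⟨p, hp, lt_of_le_of_lt (Real.le_sqrt_of_sq_le ?_) hlt,
    lt_of_le_of_lt (Real.le_sqrt_of_sq_le ?_) hlt⟩
  · exact le_add_of_nonneg_right (sq_nonneg _)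
  · exact le_add_of_nonneg_left (sq_nonneg _)

theorem inner_ne_zero_of_dist_lt_one {F : Type*} [NormedAddCommGroup F] [InnerProductSpace ℝ F]
    {u v : F} (hu : ‖u‖ = 1) (hv : ‖v‖ = 1) (h : dist u v < 1) : inner ℝ u v ≠ (0 : ℝ) := by
  intro h0
  have h1 := norm_sub_sq_real u v
  rw [hu, hv, h0, ← dist_eq_norm] at h1
  nlinarith [dist_nonneg (x := u) (y := v)]

end HypSurf

/-! ### Choice of constants and assembly -/

theorem mainTheorem5 {n : ℕ}
    -- `S` is a compact connected hypersurface of class `C²` bounding the domain `Ω`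
    (Ω S : Set (EuclideanSpace ℝ (Fin n)))
    (hΩo : IsOpen Ω) (hΩc : IsConnected Ω) (hΩb : Bornology.IsBounded Ω) (hΩS : frontier Ω = S)
    (hS : HypSurf.IsHypersurface 2 S) (hSk : IsCompact S) (hSc : IsConnected S)
    (νS : EuclideanSpace ℝ (Fin n) → EuclideanSpace ℝ (Fin n))
    (hνS : HypSurf.IsOuterUnitNormalField Ω S νS) :
    ∃ a : ℝ, 0 < a ∧ a ≤ 1 ∧ HypSurf.IsTubularWidth S νS a ∧
    ∃ ε₀ : ℝ, 0 < ε₀ ∧ ε₀ ≤ a / 3 ∧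
    ∀ ε : ℝ, 0 < ε → ε ≤ ε₀ →
    ∀ (Γ : Set (EuclideanSpace ℝ (Fin n)))
      (νΓ : EuclideanSpace ℝ (Fin n) → EuclideanSpace ℝ (Fin n)),
      HypSurf.IsHypersurface 1 Γ → IsCompact Γ → IsConnected Γ →
      HypSurf.IsUnitNormalField Γ νΓ → HypSurf.C1Close ε Γ νΓ S νS →
      ∃ ρ : EuclideanSpace ℝ (Fin n) → ℝ,
        -- `Γ` is a normal graph over `S`
        HypSurf.IsCkOn 1 S ρ ∧ (∀ p ∈ S, |ρ p| < ε) ∧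
        Γ = (fun p => p + ρ p • νS p) '' S ∧
        (∀ x, Metric.infDist x S < a →
          (x ∈ Γ ↔ HypSurf.signedDist Ω S x = ρ (HypSurf.nearestPoint S x))) ∧
        -- the parameterization is a diffeomorphism
        HypSurf.IsCkDiffeo 1 S Γ (fun p => p + ρ p • νS p) ∧
        (HypSurf.IsHypersurface 3 S → HypSurf.IsHypersurface 2 Γ →
          HypSurf.IsCkOn 2 S ρ ∧ HypSurf.IsCkDiffeo 2 S Γ (fun p => p + ρ p • νS p)) ∧
        -- `Γ` has a level function of class `C¹`, for instance the explicit one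
        (∃ ψ : EuclideanSpace ℝ (Fin n) → ℝ, HypSurf.IsC1LevelFunction Γ ψ) ∧
        (∀ χ : ℝ → ℝ, HypSurf.IsCutoff χ →
          HypSurf.IsC1LevelFunction Γ (fun x =>
            HypSurf.canonicalLevel Ω S a χ x -
              ρ (HypSurf.nearestPoint S x) * χ (3 * HypSurf.signedDist Ω S x / a))) := by
  have hν := hνS.toIsUnitNormalField
  have hne := hSc.nonempty
  obtain ⟨C, hC1, hC⟩ := HypSurf.exists_quadraticBound hS hSk hν
  obtain ⟨a, ha0, ha1, ha⟩ : ∃ a : ℝ, 0 < a ∧ a ≤ 1 ∧ 4 * C * a ≤ 1 := by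
    refine ⟨1 / (4 * C), by positivity, ?_, ?_⟩
    · rw [div_le_one (by positivity)]; linarith
    · rw [mul_one_div_cancel (by positivity)]
  have hT := hC.isTube ha hS hSk hne hΩo hΩS hνS
  have h12 : (1 : WithTop ℕ∞) + 1 = 2 := one_add_one_eq_two
  have h23 : (2 : WithTop ℕ∞) + 1 = 3 := two_add_one_eq_three
  have h1t : (1 : WithTop ℕ∞) ≠ ∞ := by decide
  have h2t : (2 : WithTop ℕ∞) ≠ ∞ := by decide
  have hPR := hT.contDiffOn hC ha le_rfl h1t (h12 ▸ hS) hν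
  have hν1 : HypSurf.IsCkOn 1 S νS := HypSurf.IsHypersurface.isCkOn_normal (h12 ▸ hS) hν
  refine ⟨a, ha0, ha1, HypSurf.isTubularWidth hT hPR hν1, ?_⟩
  obtain ⟨δ, hδ, hunif⟩ := Metric.uniformContinuousOn_iff.1
    (hSk.uniformContinuousOn_of_continuous hν.continuousOn) (1 / 2) one_half_pos
  -- `δ / 2`: a close point `p` and the nearest point of `q` are less than `2 * ε ≤ δ` apart, so
  -- their normals differ by less than `1 / 2`. `1 / 4`: adding the error `ε` keeps the total below
  -- 1, which excludes orthogonality.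
  refine ⟨min (a / 3) (min (δ / 2) (1 / 4)), by positivity, min_le_left _ _, ?_⟩
  intro ε hε hεle Γ νΓ hΓ hΓk hΓc hνΓ hclose
  have hεa : ε ≤ a / 3 := hεle.trans (min_le_left _ _)
  have hεδ : ε ≤ δ / 2 := hεle.trans ((min_le_right _ _).trans (min_le_left _ _))
  have hε4 : ε ≤ 1 / 4 := hεle.trans ((min_le_right _ _).trans (min_le_right _ _))
  have hnear := fun q (hq : q ∈ Γ) => hclose.exists_near hSk hΓk hne hν hνΓ hq
  have hΓε : ∀ q ∈ Γ, infDist q S < ε := fun q hq => by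
    obtain ⟨p, hp, hpq, -⟩ := hnear q hq
    exact (infDist_le_dist_of_mem hp).trans_lt hpq
  have hΓU : ∀ q ∈ Γ, infDist q S < a := fun q hq => (hΓε q hq).trans_le (by linarith)
  have htrans : ∀ q ∈ Γ, inner ℝ (νΓ q) (νS (HypSurf.nearestPoint S q)) ≠ (0 : ℝ) := by
    intro q hq
    obtain ⟨p, hp, hpq, hνpq⟩ := hnear q hq
    obtain ⟨hP, hPd⟩ := HypSurf.nearestPoint_spec hSk hne q
    refine HypSurf.inner_ne_zero_of_dist_lt_one (hνΓ.norm_eq_one q hq) (hν.norm_eq_one _ hP) ?_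
    have h1 : dist p (HypSurf.nearestPoint S q) < δ := by
      have := dist_triangle_left p (HypSurf.nearestPoint S q) q
      have := hΓε q hq
      linarith
    linarith [hunif p hp _ hP h1, dist_triangle (νΓ q) (νS p) (νS (HypSurf.nearestPoint S q))]
  have hloc := fun q (hq : q ∈ Γ) => hT.exists_isLocalSection le_rfl h1t hPR hν1 hν hΓ hνΓ hq
    (hΓU q hq) (htrans q hq)
  have hbij := hT.bijOn_proj hPR.continuousOn hSc.isPreconnected hΓk hΓc hΓU
    (fun q hq => (hloc q hq).1) fun q hq => (hloc q hq).2
  obtain ⟨ρ, hρ⟩ : ∃ ρ : EuclideanSpace ℝ (Fin n) → ℝ, ∀ q ∈ Γ,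
      ρ (HypSurf.nearestPoint S q) = HypSurf.signedDist Ω S q :=
    ⟨fun p => HypSurf.signedDist Ω S (Function.invFunOn (HypSurf.nearestPoint S) Γ p),
      fun q hq => congrArg _ (hbij.injOn.leftInvOn_invFunOn hq)⟩
  have hgraph : ∀ q ∈ Γ, HypSurf.nearestPoint S q +
      ρ (HypSurf.nearestPoint S q) • νS (HypSurf.nearestPoint S q) = q := fun q hq => by
    rw [hρ q hq, hT.add_eq q (hΓU q hq)]
  obtain ⟨hρ1, hdiff1⟩ := hT.isCkOn_graph hPR hΓU hbij hρ fun q hq => (hloc q hq).1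
  have hρε : ∀ p ∈ S, |ρ p| < ε := by
    intro p hp
    obtain ⟨q, hq, rfl⟩ := hbij.surjOn hp
    rw [hρ q hq, HypSurf.abs_signedDist]
    exact hΓε q hq
  have hmem : ∀ x, infDist x S < a →
      (x ∈ Γ ↔ HypSurf.signedDist Ω S x = ρ (HypSurf.nearestPoint S x)) := by
    refine fun x hx => ⟨fun h => (hρ x h).symm, fun h => ?_⟩
    obtain ⟨q, hq, hqx⟩ := hbij.surjOn (hT.proj_mem x hx)
    have h1 := hgraph q hq
    rw [hqx, ← h, hT.add_eq x hx] at h1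
    rwa [h1]
  have hlevel := fun (χ : ℝ → ℝ) (hχ : HypSurf.IsCutoff χ) =>
    HypSurf.isC1LevelFunction hT ha0 hPR hΩo hΩS hSk hne hν hεa hρ1 hρε hΓε hmem hχ
  refine ⟨ρ, hρ1, hρε, ?_, hmem, hdiff1, fun hS3 hΓ2 => ?_, ?_, hlevel⟩
  · refine Subset.antisymm (fun q hq => ⟨_, hbij.mapsTo hq, hgraph q hq⟩) ?_
    rintro _ ⟨p, hp, rfl⟩
    exact hdiff1.2.1 hp
  · have hPR2 := hT.contDiffOn hC ha one_le_two h2t (h23 ▸ hS3) hν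
    have hν2 : HypSurf.IsCkOn 2 S νS := HypSurf.IsHypersurface.isCkOn_normal (h23 ▸ hS3) hν
    exact hT.isCkOn_graph hPR2 hΓU hbij hρ fun q hq =>
      (hT.exists_isLocalSection one_le_two h2t hPR2 hν2 hν hΓ2 hνΓ hq (hΓU q hq) (htrans q hq)).1
  · obtain ⟨χ, hχ⟩ := HypSurf.exists_isCutoff
    exact ⟨_, hlevel χ hχ⟩
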